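/- **Conventions.** Composition in a groupoid is written additively ($a+b$ is defined when $\beta a=\alpha b$, where $\alpha,\beta$ are source and target); all actions are on the right. A crossed module of groupoids $\mathcal C=(C,G,\delta)$ over an object set $X$ consists of a groupoid $G$ and a totally intransitive groupoid $C$ over $X$, a right action $c^a\in C(y)$ ($c\in C(x)$, $a\in G(x,y)$) of $G$ on $C$, and a morphism $\delta:C\to G$ that is the identity on objects, with $\delta(c^a)=-a+\delta c+a$ and $c^{\delta c_1}=-c_1+c+c_1$. A homotopy $(s_0,s_1,g)$ on an endomorphism $g$ of $\mathcal C$ consists of $s_0:X\to G$, $s_1:G\to C$ with $\beta s_0(x)=g_0x$, $\beta s_1(a)=\beta g_1(a)$ and $s_1(a+b)=s_1(a)^{g_1b}+s_1(b)$. Its source is the endomorphism $f$ with $f_0x=\alpha s_0(x)$, $f_1a=s_0(\alpha a)+g_1a+\delta s_1(a)-s_0(\beta a)$, $f_2c=(g_2c+s_1\delta c)^{-s_0(\beta c)}$. **$\mathsf{AUT}(\mathcal C)$.** The internal hom $\mathsf{END}(\mathcal C)$ has as objects the endomorphisms of $\mathcal C$, as arrows $f\to g$ the homotopies on $g$ with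 source $f$, and as two-dimensional elements at $f$ the pairs $(s_2,f)$ with $s_2:X\to C$, $\beta s_2(x)=f_0x$. Its operations are as follows. Two-dimensional elements are added pointwise. The sum of $(s_0,s_1,f):f'\to f$ and $(t_0,t_1,g):f\to g$ is $(x\mapsto s_0(x)+t_0(x),\ a\mapsto t_1(a)+s_1(a)^{t_0(\beta a)},\ g)$. The action is $(s_2,f)^{(t_0,t_1,g)}=(x\mapsto s_2(x)^{t_0(x)},g)$. The boundary is $(s_2,f)\mapsto(\delta s_2,\ a\mapsto -s_2(\alpha a)^{f_1a}+s_2(\beta a),\ f)$. $\mathsf{AUT}(\mathcal C)$ is the full sub-crossed module on the set $A_0=\mathrm{Aut}(\mathcal C)$ of automorphisms. It carries the composition of $A_0$ as multiplication, together with $$f_1.(s_0,s_1,f)=(f_1s_0,f_1s_1,f_1f),\quad (s_0,s_1,f).f_2=(s_0f_2,s_1f_2,ff_2),$$ $$f_1.(s_2,f)=(f_1s_2,f_1f),\quad (s_2,f).f_2=(s_2f_2,ff_2),\quad \{(s_0,s_1,f),(t_0,t_1,f')\}=(s_1t_0,ff').$$ **The groups.** $M_2(\mathcal C)$ is the group of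 sections $s_2:X\to C$ of $\beta$ under pointwise addition. $FDer^*(\mathcal C)$ is the group of units of the monoid of free derivations, that is, homotopies $s=(s_0,s_1)$ on the identity; writing $\Delta(s)$ for the source of $s$ and $g=\Delta(t)$, the product is $(s*t)_0(x)=s_0(g_0x)+t_0(x)$, $(s*t)_1(a)=t_1(a)+s_1(g_1a)^{t_0(\beta a)}$. $M(G)$ is the group of units of the monoid of maps $s_0:X\to G$ with $\beta s_0(x)=x$ under $(s_0*t_0)(x)=s_0(\alpha t_0(x))+t_0(x)$. $Der^*(\mathcal C)$ is the group of units of the monoid of free derivations with $s_0(x)=1_x$ for all $x$; for $s\in FDer^*(\mathcal C)$ one has $s_0\in M(G)$ and $(1,s_1)\in Der^*(\mathcal C)$. **The equivalence.** A braided regular crossed module is a crossed module $\mathcal A=(A_2,A_1,\delta)$ of groupoids with a monoid bimorphism (a monoid structure on $A_0$ acting on both sides of $\mathcal A$, and a braiding $\{\,,\}:A_1\times A_1\to A_2$, satisfying the Brown–Gilbert axioms) such that $A_0$ is a group. The Brown–Gilbert equivalence assigns to it the 2-crossed module (in the sense of Conduché) $A_2(e)\xrightarrow{\delta}K\xrightarrow{\alpha}A_0$,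 where $e$ is the identity of $A_0$, $K=\{a\in A_1:\beta a=e\}$ with product $ab=a.(\alpha b)+b$, $A_0$ acts by $z^p=p^{-1}.z.p$, $K$ acts on $A_2(e)$ by $c!a=(c.\alpha a)^a$, and $\langle a,b\rangle=\{a^{-1},b\}!a$. In the other direction it assigns to a 2-crossed module $L\to M\to P$ the crossed module with objects $P$, arrows $M\times P$ and two-dimensional elements $L\times P$, in which $\alpha(g,p)=\partial(g)p$, $\beta(g,p)=p$, $(g_1,p_1)+(g_2,p_2)=(g_1g_2,p_2)$, $(l_1,p)+(l_2,p)=(l_1l_2,p)$, $\delta(l,p)=(\partial l,p)$, $(l,p)^{(g,q)}=(l^g,q)$, $p.(g,q)=(g^{p^{-1}},pq)$, $(g,q).p=(g,qp)$, $p.(l,q)=(l^{p^{-1}},pq)$, $(l,q).p=(l,qp)$ and $\{(g_1,p_1),(g_2,p_2)\}=(\langle g_1^{-1},g_2^{p_1^{-1}}\rangle^{g_1},p_1p_2)$. **Theorem.** Let $\mathcal C=(C,G,\delta)$ be a crossed module of groupoids. Then: 1. $\mathsf{AUT}(\mathcal C)$ with the structure above is a braided regular crossed module. 2. $$M_2(\mathcal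 C)\xrightarrow{\ \zeta\ }FDer^*(\mathcal C)\xrightarrow{\ \Delta\ }\mathrm{Aut}(\mathcal C)$$ is a 2-crossed module, with $\zeta(s_2)=(\delta s_2,\ a\mapsto -s_2(\alpha a)^a+s_2(\beta a))$, with $\mathrm{Aut}(\mathcal C)$ acting by $s_2^f=f^{-1}s_2f$ and $(s_0,s_1)^f=(f^{-1}s_0f,f^{-1}s_1f)$, with $FDer^*(\mathcal C)$ acting on $M_2(\mathcal C)$ by $s_2^{(t_0,t_1)}(x)=s_2(\alpha t_0(x))^{t_0(x)}$, and with Peiffer lifting $$\langle(s_0,s_1),(t_0,t_1)\rangle(x)=s_1^{-1}\big((s_0^{-1}*t_0*s_0)(x)\big),$$ where $s_1^{-1}$ is the second component of the inverse of $(1,s_1)$ in $Der^*(\mathcal C)$ and $s_0^{-1}*t_0*s_0$ is formed in $M(G)$. 3. $\mathsf{AUT}(\mathcal C)$ corresponds to this 2-crossed module under the Brown–Gilbert equivalence: the 2-crossed module associated with $\mathsf{AUT}(\mathcal C)$ is isomorphic to it by the identifications $(s_2,1)\mapsto s_2$, $(s_0,s_1,1)\mapsto(s_0,s_1)$, $f\mapsto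 f$, and the braided regular crossed module associated with it is isomorphic to $\mathsf{AUT}(\mathcal C)$ by an isomorphism that is the identity on objects. -/

import Mathlib

universe u v w u' v' w' u'' v'' w''

/-- A crossed module of groupoids `δ : C → G` over a common object set.
The groupoid `G` is given by its set `Arr` of arrows with source and target maps `src`, `tgt`
and a partially defined composition `comp a b` (written `a + b` in additive notation),
defined when `tgt a = src b`. The totally intransitive groupoid `C` is given by its set `Cell`
of arrows, with `base` the common source and target map.
`act c a` is the right action `c ^ a`, defined when `base c = src a`, and `bd` is `δ`. -/
structure XMod where
  Ob : Type u
  Arr : Type v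
  Cell : Type w
  -- the groupoid `G`
  src : Arr → Ob
  tgt : Arr → Ob
  one : Ob → Arr
  comp : (a b : Arr) → tgt a = src b → Arr
  inv : Arr → Arr
  src_one : ∀ x, src (one x) = x
  tgt_one : ∀ x, tgt (one x) = x
  src_comp : ∀ a b h, src (comp a b h) = src a
  tgt_comp : ∀ a b h, tgt (comp a b h) = tgt b
  src_inv : ∀ a, src (inv a) = tgt a
  tgt_inv : ∀ a, tgt (inv a) = src a
  comp_assoc : ∀ a b c (h₁ : tgt a = src b) (h₂ : tgt b = src c),
    comp (comp a b h₁) c ((tgt_comp a b h₁).trans h₂) =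
      comp a (comp b c h₂) (h₁.trans (src_comp b c h₂).symm)
  one_comp : ∀ a, comp (one (src a)) a (tgt_one _) = a
  comp_one : ∀ a, comp a (one (tgt a)) (src_one _).symm = a
  inv_comp : ∀ a, comp (inv a) a (tgt_inv a) = one (tgt a)
  comp_inv : ∀ a, comp a (inv a) (src_inv a).symm = one (src a)
  -- the totally intransitive groupoid `C`
  base : Cell → Ob
  zero : Ob → Cell
  add : (c d : Cell) → base c = base d → Cell
  neg : Cell → Cell
  base_zero : ∀ x, base (zero x) = x
  base_add : ∀ c d h, base (add c d h) = base c
  base_neg : ∀ c, base (neg c) = base c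
  add_assoc : ∀ c d e (h₁ : base c = base d) (h₂ : base d = base e),
    add (add c d h₁) e ((base_add c d h₁).trans (h₁.trans h₂)) =
      add c (add d e h₂) (h₁.trans (base_add d e h₂).symm)
  zero_add : ∀ c, add (zero (base c)) c (base_zero _) = c
  add_zero : ∀ c, add c (zero (base c)) (base_zero _).symm = c
  neg_add : ∀ c, add (neg c) c (base_neg c) = zero (base c)
  add_neg : ∀ c, add c (neg c) (base_neg c).symm = zero (base c)
  -- the action of `G` on `C`
  act : (c : Cell) → (a : Arr) → base c = src a → Cell
  base_act : ∀ c a h, base (act c a h) = tgt a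
  act_add : ∀ c d a (h : base c = base d) (h' : base d = src a),
    act (add c d h) a ((base_add c d h).trans (h.trans h')) =
      add (act c a (h.trans h')) (act d a h') ((base_act _ _ _).trans (base_act _ _ _).symm)
  act_comp : ∀ c a b (h : base c = src a) (h' : tgt a = src b),
    act c (comp a b h') (h.trans (src_comp a b h').symm) =
      act (act c a h) b ((base_act c a h).trans h')
  act_one : ∀ c, act c (one (base c)) (src_one _).symm = c
  -- the boundary `δ`, a morphism of groupoids that is the identity on objects
  bd : Cell → Arr
  src_bd : ∀ c, src (bd c) = base c
  tgt_bd : ∀ c, tgt (bd c) = base c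
  bd_add : ∀ c d (h : base c = base d),
    bd (add c d h) = comp (bd c) (bd d) ((tgt_bd c).trans (h.trans (src_bd d).symm))
  -- the two crossed module axioms
  bd_act : ∀ c a (h : base c = src a),
    bd (act c a h) = comp (comp (inv a) (bd c) ((tgt_inv a).trans (h.symm.trans (src_bd c).symm)))
      a ((tgt_comp _ _ _).trans ((tgt_bd c).trans h))
  act_bd : ∀ c d (h : base c = base d),
    act c (bd d) (h.trans (src_bd d).symm) =
      add (add (neg d) c ((base_neg d).trans h.symm)) d
        ((base_add _ _ _).trans (base_neg d))

namespace XMod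

attribute [simp] src_one tgt_one src_comp tgt_comp src_inv tgt_inv inv_comp comp_inv
  base_zero base_add base_neg neg_add add_neg base_act src_bd tgt_bd

section Lemmas

variable (C : XMod.{u, v, w})

@[simp] theorem assoc' {a b c : C.Arr} (h₁ : C.tgt a = C.src b)
    (h₂ : C.tgt (C.comp a b h₁) = C.src c) :
    C.comp (C.comp a b h₁) c h₂ =
      C.comp a (C.comp b c (by simpa using h₂)) (by simpa using h₁) :=
  C.comp_assoc a b c h₁ (by simpa using h₂)

@[simp] theorem add_assoc' {a b c : C.Cell} (h₁ : C.base a = C.base b)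
    (h₂ : C.base (C.add a b h₁) = C.base c) :
    C.add (C.add a b h₁) c h₂ =
      C.add a (C.add b c (by rw [← h₁]; simpa using h₂)) (by simpa using h₁) :=
  C.add_assoc a b c h₁ (by rw [← h₁]; simpa using h₂)

@[simp] theorem one_comp' {x : C.Ob} {a : C.Arr} (h : C.tgt (C.one x) = C.src a) :
    C.comp (C.one x) a h = a := by
  obtain rfl : x = C.src a := by simpa using h
  exact C.one_comp a

@[simp] theorem comp_one' {x : C.Ob} {a : C.Arr} (h : C.tgt a = C.src (C.one x)) :
    C.comp a (C.one x) h = a := by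
  obtain rfl : C.tgt a = x := by simpa using h
  exact C.comp_one a

@[simp] theorem zero_add' {x : C.Ob} {a : C.Cell} (h : C.base (C.zero x) = C.base a) :
    C.add (C.zero x) a h = a := by
  obtain rfl : x = C.base a := by simpa using h
  exact C.zero_add a

@[simp] theorem add_zero' {x : C.Ob} {a : C.Cell} (h : C.base a = C.base (C.zero x)) :
    C.add a (C.zero x) h = a := by
  obtain rfl : C.base a = x := by simpa using h
  exact C.add_zero a

@[simp] theorem inv_comp_cancel {a b : C.Arr} (h : C.tgt a = C.src b)
    (h' : C.tgt (C.inv a) = C.src (C.comp a b h)) :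
    C.comp (C.inv a) (C.comp a b h) h' = b := by
  have := C.comp_assoc (C.inv a) a b (by simp) h
  rw [← this]; simp only [inv_comp, one_comp']

@[simp] theorem comp_inv_cancel {a b : C.Arr} (h : C.tgt (C.inv a) = C.src b)
    (h' : C.tgt a = C.src (C.comp (C.inv a) b h)) :
    C.comp a (C.comp (C.inv a) b h) h' = b := by
  have := C.comp_assoc a (C.inv a) b (by simp) h
  rw [← this]; simp only [comp_inv, one_comp']

@[simp] theorem neg_add_cancel {a b : C.Cell} (h : C.base a = C.base b)
    (h' : C.base (C.neg a) = C.base (C.add a b h)) :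
    C.add (C.neg a) (C.add a b h) h' = b := by
  have := C.add_assoc (C.neg a) a b (by simp) h
  rw [← this]; simp only [neg_add, zero_add']

@[simp] theorem add_neg_cancel {a b : C.Cell} (h : C.base (C.neg a) = C.base b)
    (h' : C.base a = C.base (C.add (C.neg a) b h)) :
    C.add a (C.add (C.neg a) b h) h' = b := by
  have := C.add_assoc a (C.neg a) b (by simp) h
  rw [← this]; simp only [add_neg, zero_add']

theorem comp_left_cancel {a b c : C.Arr} (h : C.tgt a = C.src b) (h' : C.tgt a = C.src c)
    (e : C.comp a b h = C.comp a c h') : b = c := by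
  have h1 := C.inv_comp_cancel h (by simp)
  have h2 := C.inv_comp_cancel h' (by simp)
  rw [← h1, ← h2]; simp only [e]

theorem add_left_cancel {a b c : C.Cell} (h : C.base a = C.base b) (h' : C.base a = C.base c)
    (e : C.add a b h = C.add a c h') : b = c := by
  have h1 := C.neg_add_cancel h (by simp)
  have h2 := C.neg_add_cancel h' (by simp)
  rw [← h1, ← h2]; simp only [e]

@[simp] theorem inv_inv (a : C.Arr) : C.inv (C.inv a) = a :=
  C.comp_left_cancel (a := C.inv a) (by simp) (by simp) (by simp)

@[simp] theorem neg_neg (a : C.Cell) : C.neg (C.neg a) = a :=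
  C.add_left_cancel (a := C.neg a) (by simp) (by simp) (by simp)

@[simp] theorem inv_one (x : C.Ob) : C.inv (C.one x) = C.one x :=
  C.comp_left_cancel (a := C.one x) (by simp) (by simp) (by rw [C.comp_inv]; simp)

@[simp] theorem neg_zero (x : C.Ob) : C.neg (C.zero x) = C.zero x :=
  C.add_left_cancel (a := C.zero x) (by simp) (by simp) (by rw [C.add_neg]; simp)

@[simp] theorem inv_comp_rev {a b : C.Arr} (h : C.tgt a = C.src b) :
    C.inv (C.comp a b h) = C.comp (C.inv b) (C.inv a) (by simp [h]) :=
  C.comp_left_cancel (a := C.comp a b h) (by simp) (by simp) (by rw [C.comp_inv]; simp)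

@[simp] theorem neg_add_rev {a b : C.Cell} (h : C.base a = C.base b) :
    C.neg (C.add a b h) = C.add (C.neg b) (C.neg a) (by simp [h]) :=
  C.add_left_cancel (a := C.add a b h) (by simp) (by simp [h]) (by rw [C.add_neg]; simp)

@[simp] theorem act_act {c : C.Cell} {a b : C.Arr} (h : C.base c = C.src a)
    (h' : C.base (C.act c a h) = C.src b) :
    C.act (C.act c a h) b h' = C.act c (C.comp a b (by simpa using h')) (by simpa using h) :=
  (C.act_comp c a b h (by simpa using h')).symm

@[simp] theorem act_one' {c : C.Cell} {x : C.Ob} (h : C.base c = C.src (C.one x)) :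
    C.act c (C.one x) h = c := by
  obtain rfl : C.base c = x := by simpa using h
  exact C.act_one c

@[simp] theorem act_add' {c d : C.Cell} {a : C.Arr} (h : C.base c = C.base d)
    (h' : C.base (C.add c d h) = C.src a) :
    C.act (C.add c d h) a h' =
      C.add (C.act c a (by simpa using h')) (C.act d a (by rw [← h]; simpa using h'))
        (by simp) :=
  C.act_add c d a h (by rw [← h]; simpa using h')

@[simp] theorem act_zero {x : C.Ob} {a : C.Arr} (h : C.base (C.zero x) = C.src a) :
    C.act (C.zero x) a h = C.zero (C.tgt a) := by
  have e := C.act_add (C.zero x) (C.zero x) a rfl h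
  refine C.add_left_cancel (a := C.act (C.zero x) a h) (by simp) (by simp) ?_
  rw [← e]; simp

@[simp] theorem act_neg {c : C.Cell} {a : C.Arr} (h : C.base (C.neg c) = C.src a) :
    C.act (C.neg c) a h = C.neg (C.act c a (by simpa using h)) := by
  have e := C.act_add c (C.neg c) a (by simp) h
  refine C.add_left_cancel (a := C.act c a (by simpa using h)) (by simp) (by simp) ?_
  rw [← e]; simp only [add_neg, act_zero, base_act]

@[simp] theorem bd_zero (x : C.Ob) : C.bd (C.zero x) = C.one x := by
  have e := C.bd_add (C.zero x) (C.zero x) rfl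
  refine C.comp_left_cancel (a := C.bd (C.zero x)) (by simp) (by simp) ?_
  rw [← e]; simp

@[simp] theorem bd_neg (c : C.Cell) : C.bd (C.neg c) = C.inv (C.bd c) := by
  have e := C.bd_add c (C.neg c) (by simp)
  refine C.comp_left_cancel (a := C.bd c) (by simp) (by simp) ?_
  rw [← e]; simp

@[simp] theorem bd_add' {c d : C.Cell} (h : C.base c = C.base d) :
    C.bd (C.add c d h) = C.comp (C.bd c) (C.bd d) (by simp [h]) := C.bd_add c d h

@[simp] theorem bd_act' {c : C.Cell} {a : C.Arr} (h : C.base c = C.src a) :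
    C.bd (C.act c a h) = C.comp (C.inv a) (C.comp (C.bd c) a (by simp [h])) (by simp [h]) := by
  rw [C.bd_act]; simp

theorem act_bd' {c d : C.Cell} (h : C.base c = C.src (C.bd d)) :
    C.act c (C.bd d) h = C.add (C.neg d) (C.add c d (by simpa using h)) (by simp at h; simp [h]) := by
  rw [C.act_bd c d (by simpa using h)]; simp

theorem act_bd_comp {c d : C.Cell} {b : C.Arr} (h : C.tgt (C.bd d) = C.src b)
    (h' : C.base c = C.src (C.comp (C.bd d) b h)) :
    C.act c (C.comp (C.bd d) b h) h' =
      C.add (C.neg (C.act d b (by simpa using h)))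
        (C.add (C.act c b (by simp at h h'; rw [h', h])) (C.act d b (by simpa using h)) (by simp))
        (by simp) := by
  have e := C.act_comp c (C.bd d) b (by simpa using h') h
  rw [e]; simp only [act_bd', act_add', act_neg]

theorem act_comp_bd {c d : C.Cell} {a : C.Arr} (h : C.tgt a = C.src (C.bd d))
    (h' : C.base c = C.src (C.comp a (C.bd d) h)) :
    C.act c (C.comp a (C.bd d) h) h' =
      C.add (C.neg d) (C.add (C.act c a (by simpa using h')) d (by simpa using h))
        (by simp at h; simp [h]) := by
  have e := C.act_comp c a (C.bd d) (by simpa using h') h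
  rw [e]; simp only [act_bd']

theorem act_comp_bd_comp {c d : C.Cell} {a b : C.Arr} (h₁ : C.tgt (C.bd d) = C.src b)
    (h : C.tgt a = C.src (C.comp (C.bd d) b h₁))
    (h' : C.base c = C.src (C.comp a (C.comp (C.bd d) b h₁) h)) :
    C.act c (C.comp a (C.comp (C.bd d) b h₁) h) h' =
      C.add (C.neg (C.act d b (by simpa using h₁)))
        (C.add (C.act c (C.comp a b (by simp at h₁ h; rw [h, h₁])) (by simpa using h'))
          (C.act d b (by simpa using h₁)) (by simp))
        (by simp) := by
  have e := C.act_comp c a (C.comp (C.bd d) b h₁) (by simpa using h') h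
  rw [e]; simp only [act_bd_comp, act_act]

theorem act_comp_comp_bd {c d : C.Cell} {a b : C.Arr} (h₁ : C.tgt b = C.src (C.bd d))
    (h : C.tgt a = C.src (C.comp b (C.bd d) h₁))
    (h' : C.base c = C.src (C.comp a (C.comp b (C.bd d) h₁) h)) :
    C.act c (C.comp a (C.comp b (C.bd d) h₁) h) h' =
      C.add (C.neg d)
        (C.add (C.act c (C.comp a b (by simpa using h)) (by simpa using h')) d
          (by simpa using h₁))
        (by simp at h₁; simp [h₁]) := by
  have e := C.act_comp_bd (c := c) (d := d) (a := C.comp a b (by simpa using h))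
    (by simpa using h₁) (by simpa using h')
  rw [← e]; simp only [assoc']

theorem act_inv_bd {c d : C.Cell} (h : C.base c = C.src (C.inv (C.bd d))) :
    C.act c (C.inv (C.bd d)) h =
      C.add d (C.add c (C.neg d) (by simpa using h)) (by simp at h; simp [h]) := by
  have e := C.act_bd' (c := c) (d := C.neg d) (by simpa using h)
  simp only [bd_neg, neg_neg] at e
  exact e

end Lemmas

end XMod

namespace XMod

/-- A morphism of crossed modules of groupoids. -/
@[ext]
structure Hom (C : XMod.{u, v, w}) (D : XMod.{u', v', w'}) where
  f0 : C.Ob → D.Ob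
  f1 : C.Arr → D.Arr
  f2 : C.Cell → D.Cell
  src_f1 : ∀ a, D.src (f1 a) = f0 (C.src a)
  tgt_f1 : ∀ a, D.tgt (f1 a) = f0 (C.tgt a)
  base_f2 : ∀ c, D.base (f2 c) = f0 (C.base c)
  f1_comp : ∀ a b (h : C.tgt a = C.src b),
    f1 (C.comp a b h) = D.comp (f1 a) (f1 b) (by rw [tgt_f1, src_f1, h])
  f2_add : ∀ c d (h : C.base c = C.base d),
    f2 (C.add c d h) = D.add (f2 c) (f2 d) (by rw [base_f2, base_f2, h])
  f1_bd : ∀ c, f1 (C.bd c) = D.bd (f2 c)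
  f2_act : ∀ c a (h : C.base c = C.src a),
    f2 (C.act c a h) = D.act (f2 c) (f1 a) (by rw [base_f2, src_f1, h])

namespace Hom

attribute [simp] src_f1 tgt_f1 base_f2 f1_comp f2_add f1_bd f2_act

section

variable {C : XMod.{u, v, w}} {D : XMod.{u', v', w'}} (f : Hom C D)

@[simp] theorem f1_one (x : C.Ob) : f.f1 (C.one x) = D.one (f.f0 x) := by
  refine D.comp_left_cancel (a := f.f1 (C.one x)) (by simp) (by simp) ?_
  rw [← f.f1_comp _ _ (by simp)]; simp

@[simp] theorem f2_zero (x : C.Ob) : f.f2 (C.zero x) = D.zero (f.f0 x) := by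
  refine D.add_left_cancel (a := f.f2 (C.zero x)) (by simp) (by simp) ?_
  rw [← f.f2_add _ _ (by simp)]; simp

@[simp] theorem f1_inv (a : C.Arr) : f.f1 (C.inv a) = D.inv (f.f1 a) := by
  refine D.comp_left_cancel (a := f.f1 a) (by simp) (by simp) ?_
  rw [← f.f1_comp _ _ (by simp)]; simp

@[simp] theorem f2_neg (c : C.Cell) : f.f2 (C.neg c) = D.neg (f.f2 c) := by
  refine D.add_left_cancel (a := f.f2 c) (by simp) (by simp) ?_
  rw [← f.f2_add _ _ (by simp)]; simp

end

/-- Composition of morphisms: `comp g f = g ∘ f`. -/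
@[simps]
def comp {C : XMod.{u, v, w}} {D : XMod.{u', v', w'}} {E : XMod.{u'', v'', w''}}
    (g : Hom D E) (f : Hom C D) : Hom C E where
  f0 := g.f0 ∘ f.f0
  f1 := g.f1 ∘ f.f1
  f2 := g.f2 ∘ f.f2
  src_f1 a := by simp
  tgt_f1 a := by simp
  base_f2 c := by simp
  f1_comp a b h := by simp
  f2_add c d h := by simp
  f1_bd c := by simp
  f2_act c a h := by simp

/-- The identity morphism. -/
@[simps]
def id (C : XMod.{u, v, w}) : Hom C C where
  f0 := _root_.id
  f1 := _root_.id
  f2 := _root_.id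
  src_f1 _ := rfl
  tgt_f1 _ := rfl
  base_f2 _ := rfl
  f1_comp _ _ _ := rfl
  f2_add _ _ _ := rfl
  f1_bd _ := rfl
  f2_act _ _ _ := rfl

/-- The monoid of endomorphisms under composition. -/
instance (C : XMod.{u, v, w}) : Monoid (Hom C C) where
  mul g f := comp g f
  one := id C
  mul_assoc _ _ _ := rfl
  one_mul _ := rfl
  mul_one _ := rfl

section

variable {C : XMod.{u, v, w}}

@[simp] theorem mul_f0 (g f : Hom C C) (x : C.Ob) : (g * f).f0 x = g.f0 (f.f0 x) := rfl
@[simp] theorem mul_f1 (g f : Hom C C) (a : C.Arr) : (g * f).f1 a = g.f1 (f.f1 a) := rfl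
@[simp] theorem mul_f2 (g f : Hom C C) (c : C.Cell) : (g * f).f2 c = g.f2 (f.f2 c) := rfl
@[simp] theorem one_f0 (x : C.Ob) : (1 : Hom C C).f0 x = x := rfl
@[simp] theorem one_f1 (a : C.Arr) : (1 : Hom C C).f1 a = a := rfl
@[simp] theorem one_f2 (c : C.Cell) : (1 : Hom C C).f2 c = c := rfl

end

end Hom

/-- The group `Aut(C)` of automorphisms of a crossed module. -/
abbrev Aut (C : XMod.{u, v, w}) := (Hom C C)ˣ

namespace Aut

variable {C : XMod.{u, v, w}} (f : Aut C)

@[simp] theorem inv_f0 (x : C.Ob) : (f⁻¹).val.f0 (f.val.f0 x) = x :=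
  congrArg (fun g : Hom C C => g.f0 x) f.inv_val
@[simp] theorem f0_inv (x : C.Ob) : f.val.f0 ((f⁻¹).val.f0 x) = x :=
  congrArg (fun g : Hom C C => g.f0 x) f.val_inv
@[simp] theorem inv_f1 (x : C.Arr) : (f⁻¹).val.f1 (f.val.f1 x) = x :=
  congrArg (fun g : Hom C C => g.f1 x) f.inv_val
@[simp] theorem f1_inv (x : C.Arr) : f.val.f1 ((f⁻¹).val.f1 x) = x :=
  congrArg (fun g : Hom C C => g.f1 x) f.val_inv
@[simp] theorem inv_f2 (x : C.Cell) : (f⁻¹).val.f2 (f.val.f2 x) = x :=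
  congrArg (fun g : Hom C C => g.f2 x) f.inv_val
@[simp] theorem f2_inv (x : C.Cell) : f.val.f2 ((f⁻¹).val.f2 x) = x :=
  congrArg (fun g : Hom C C => g.f2 x) f.val_inv

end Aut

/-- A homotopy `(s, g)` on a morphism `g`, with `s = (s₀, s₁)`; `s₁` is a `g`-derivation. -/
@[ext]
structure Homotopy {C : XMod.{u, v, w}} {D : XMod.{u', v', w'}} (g : Hom C D) where
  s0 : C.Ob → D.Arr
  s1 : C.Arr → D.Cell
  tgt_s0 : ∀ x, D.tgt (s0 x) = g.f0 x
  base_s1 : ∀ a, D.base (s1 a) = g.f0 (C.tgt a)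
  s1_comp : ∀ a b (h : C.tgt a = C.src b),
    s1 (C.comp a b h) =
      D.add (D.act (s1 a) (g.f1 b) (by rw [base_s1, g.src_f1, h])) (s1 b)
        (by rw [base_act, g.tgt_f1, base_s1])

namespace Homotopy

attribute [simp] tgt_s0 base_s1 s1_comp

section

variable {C : XMod.{u, v, w}} {D : XMod.{u', v', w'}} {g : Hom C D} (s : Homotopy g)

@[simp] theorem s1_one (x : C.Ob) : s.s1 (C.one x) = D.zero (g.f0 x) := by
  have h := s.s1_comp (C.one x) (C.one x) (by simp)
  refine D.add_left_cancel (a := s.s1 (C.one x)) (by simp) (by simp) ?_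
  simp only [Hom.f1_one, act_one'] at h
  rw [← h]; simp

theorem s1_inv (a : C.Arr) :
    s.s1 (C.inv a) = D.neg (D.act (s.s1 a) (D.inv (g.f1 a)) (by simp)) := by
  have h := s.s1_comp a (C.inv a) (by simp)
  refine D.add_left_cancel (a := D.act (s.s1 a) (D.inv (g.f1 a)) (by simp)) (by simp) (by simp) ?_
  simp only [Hom.f1_inv] at h
  rw [← h]; simp

/-- The morphism `f` with `(s, g) : f ≃ g`:
`f₀ x = α (s₀ x)`, `f₁ a = s₀ (α a) + g₁ a + δ (s₁ a) - s₀ (β a)` and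
`f₂ c = (g₂ c + s₁ (δ c)) ^ (- s₀ (β c))`. -/
@[simps]
def source : Hom C D where
  f0 x := D.src (s.s0 x)
  f1 a := D.comp (s.s0 (C.src a)) (D.comp (g.f1 a) (D.comp (D.bd (s.s1 a))
    (D.inv (s.s0 (C.tgt a))) (by simp)) (by simp)) (by simp)
  f2 c := D.act (D.add (g.f2 c) (s.s1 (C.bd c)) (by simp)) (D.inv (s.s0 (C.base c))) (by simp)
  src_f1 a := by simp
  tgt_f1 a := by simp
  base_f2 c := by simp
  f1_comp a b h := by simp [h]
  f2_add c d h := by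
    have e : D.bd (g.f2 d) = g.f1 (C.bd d) := by simp
    simp [h, act_bd']
  f1_bd c := by simp
  f2_act c a h := by
    simp [h, act_bd_comp, act_comp_bd_comp, s1_inv]

end

end Homotopy
end XMod

namespace XMod

namespace Homotopy

variable {C : XMod.{u, v, w}} {D : XMod.{u', v', w'}} {g : Hom C D}

/-- The same homotopy, regarded as a homotopy on an equal morphism. -/
@[simps]
def copy {g' : Hom C D} (s : Homotopy g) (h : g = g') : Homotopy g' where
  s0 := s.s0
  s1 := s.s1
  tgt_s0 := by subst h; exact s.tgt_s0
  base_s1 := by subst h; exact s.base_s1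
  s1_comp := by subst h; exact s.s1_comp

/-- The zero homotopy `g ≃ g`. -/
@[simps]
def refl (g : Hom C D) : Homotopy g where
  s0 x := D.one (g.f0 x)
  s1 a := D.zero (g.f0 (C.tgt a))
  tgt_s0 x := by simp
  base_s1 a := by simp
  s1_comp a b h := by simp

/-- The sum of homotopies `(s, f) : f' ≃ f` and `(t, g) : f ≃ g`. -/
@[simps]
def trans (t : Homotopy g) (s : Homotopy t.source) : Homotopy g where
  s0 x := D.comp (s.s0 x) (t.s0 x) (by simp)
  s1 a := D.add (t.s1 a) (D.act (s.s1 a) (t.s0 (C.tgt a)) (by simp)) (by simp)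
  tgt_s0 x := by simp
  base_s1 a := by simp
  s1_comp a b h := by
    simp [h, act_comp_comp_bd]

/-- The negative of a homotopy `(s, g) : f ≃ g`. -/
@[simps]
def symm (s : Homotopy g) : Homotopy s.source where
  s0 x := D.inv (s.s0 x)
  s1 a := D.neg (D.act (s.s1 a) (D.inv (s.s0 (C.tgt a))) (by simp))
  tgt_s0 x := by simp
  base_s1 a := by simp
  s1_comp a b h := by
    simp [h, act_comp_bd_comp]

/-- The homotopy `(δ s₂, s₁) : f ≃ f`, `s₁ a = - s₂ (α a) ^ (f₁ a) + s₂ (β a)`, attached to a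
section `s₂` over `f`. -/
@[simps]
def ofSection (f : Hom C D) (s2 : C.Ob → D.Cell) (h2 : ∀ x, D.base (s2 x) = f.f0 x) :
    Homotopy f where
  s0 x := D.bd (s2 x)
  s1 a := D.add (D.neg (D.act (s2 (C.src a)) (f.f1 a) (by simp [h2]))) (s2 (C.tgt a))
    (by simp [h2])
  tgt_s0 x := by simp [h2]
  base_s1 a := by simp
  s1_comp a b h := by simp [h]

@[simp] theorem source_copy {g' : Hom C D} (s : Homotopy g) (h : g = g') :
    (s.copy h).source = s.source := by subst h; rfl

@[simp] theorem source_refl (g : Hom C D) : (refl g).source = g := by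
  ext <;> simp

theorem source_trans (t : Homotopy g) (s : Homotopy t.source) :
    (t.trans s).source = s.source := by
  ext <;> simp

theorem source_symm (s : Homotopy g) : s.symm.source = g := by
  ext <;> simp

theorem source_ofSection (f : Hom C D) (s2 : C.Ob → D.Cell) (h2 : ∀ x, D.base (s2 x) = f.f0 x) :
    (ofSection f s2 h2).source = f := by
  ext x
  · simp [h2]
  · simp
  · have e : f.f1 (C.bd x) = D.bd (f.f2 x) := by simp
    simp [act_bd', act_inv_bd]

end Homotopy

/-- An arrow `(s₀, s₁, g)` of the internal hom: a homotopy on the morphism `g`. -/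
structure HomArr (C : XMod.{u, v, w}) (D : XMod.{u', v', w'}) where
  g : Hom C D
  s : Homotopy g

/-- A two-dimensional element `(s₂, f)` of the internal hom: a section over the morphism `f`. -/
@[ext]
structure HomSec (C : XMod.{u, v, w}) (D : XMod.{u', v', w'}) where
  f : Hom C D
  s2 : C.Ob → D.Cell
  base_s2 : ∀ x, D.base (s2 x) = f.f0 x

attribute [simp] HomSec.base_s2

theorem HomArr.ext' {C : XMod.{u, v, w}} {D : XMod.{u', v', w'}} {a b : HomArr C D}
    (h : a.g = b.g) (h0 : ∀ x, a.s.s0 x = b.s.s0 x) (h1 : ∀ x, a.s.s1 x = b.s.s1 x) : a = b := by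
  obtain ⟨g, s⟩ := a
  obtain ⟨g', t⟩ := b
  obtain rfl : g = g' := h
  obtain rfl : s = t := Homotopy.ext (funext h0) (funext h1)
  rfl

/-- The internal hom of crossed modules of groupoids: its objects are the morphisms `C → D`,
an arrow `f → g` is a homotopy `(s, g) : f ≃ g`, and its two-dimensional elements at `f` are the
sections over `f`. -/
@[simps]
def CMOD (C : XMod.{u, v, w}) (D : XMod.{u', v', w'}) : XMod where
  Ob := Hom C D
  Arr := HomArr C D
  Cell := HomSec C D
  src a := a.s.source
  tgt a := a.g
  one f := ⟨f, Homotopy.refl f⟩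
  comp a b h := ⟨b.g, b.s.trans (a.s.copy h)⟩
  inv a := ⟨a.s.source, a.s.symm⟩
  src_one f := by simp
  tgt_one f := rfl
  src_comp a b h := by rw [Homotopy.source_trans, Homotopy.source_copy]
  tgt_comp a b h := rfl
  src_inv a := by rw [Homotopy.source_symm]
  tgt_inv a := rfl
  comp_assoc a b c h₁ h₂ := by
    apply HomArr.ext' <;> simp
  one_comp a := by
    apply HomArr.ext' <;> simp
  comp_one a := by
    apply HomArr.ext' <;> simp
  inv_comp a := by
    apply HomArr.ext' <;> simp
  comp_inv a := by
    apply HomArr.ext' <;> simp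
  base c := c.f
  zero f := ⟨f, fun x => D.zero (f.f0 x), by simp⟩
  add c d h := ⟨c.f, fun x => D.add (c.s2 x) (d.s2 x) (by simp [h]), by simp⟩
  neg c := ⟨c.f, fun x => D.neg (c.s2 x), by simp⟩
  base_zero _ := rfl
  base_add _ _ _ := rfl
  base_neg _ := rfl
  add_assoc c d e h₁ h₂ := by ext <;> simp
  zero_add c := by ext <;> simp
  add_zero c := by ext <;> simp
  neg_add c := by ext <;> simp
  add_neg c := by ext <;> simp
  act c a h := ⟨a.g, fun x => D.act (c.s2 x) (a.s.s0 x) (by simp [h]), by simp⟩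
  base_act _ _ _ := rfl
  act_add c d a h h' := by ext <;> simp
  act_comp c a b h h' := by ext <;> simp
  act_one c := by ext <;> simp
  bd c := ⟨c.f, Homotopy.ofSection c.f c.s2 c.base_s2⟩
  src_bd c := Homotopy.source_ofSection c.f c.s2 c.base_s2
  tgt_bd _ := rfl
  bd_add c d h := by
    apply HomArr.ext' <;> simp [h, act_bd']
  bd_act c a h := by
    apply HomArr.ext' <;> simp [h, act_comp_comp_bd, act_comp_bd_comp]
  act_bd c d h := by ext <;> simp [act_bd']

end XMod

namespace XMod

/-! ### Full sub-crossed modules -/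

/-- An arrow of `A` together with objects `src`, `tgt` of `Y` lying over its end points. -/
@[ext]
structure FullArr (A : XMod.{u, v, w}) {Y : Type u'} (i : Y → A.Ob) where
  src : Y
  tgt : Y
  arr : A.Arr
  src_arr : A.src arr = i src
  tgt_arr : A.tgt arr = i tgt

/-- A two-dimensional element of `A` together with an object of `Y` lying over its base. -/
@[ext]
structure FullCell (A : XMod.{u, v, w}) {Y : Type u'} (i : Y → A.Ob) where
  base : Y
  cell : A.Cell
  base_cell : A.base cell = i base

attribute [simp] FullArr.src_arr FullArr.tgt_arr FullCell.base_cell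

/-- For an injective map `i : Y → Ob(A)`, the full sub-crossed module of `A` on the set of objects
`Y`. -/
@[simps]
def full (A : XMod.{u, v, w}) {Y : Type u'} (i : Y → A.Ob) : XMod where
  Ob := Y
  Arr := FullArr A i
  Cell := FullCell A i
  src a := a.src
  tgt a := a.tgt
  one y := ⟨y, y, A.one (i y), by simp, by simp⟩
  comp a b h := ⟨a.src, b.tgt, A.comp a.arr b.arr (by simp [h]), by simp, by simp⟩
  inv a := ⟨a.tgt, a.src, A.inv a.arr, by simp, by simp⟩
  src_one _ := rfl
  tgt_one _ := rfl
  src_comp _ _ _ := rfl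
  tgt_comp _ _ _ := rfl
  src_inv _ := rfl
  tgt_inv _ := rfl
  comp_assoc a b c h₁ h₂ := by ext <;> simp
  one_comp a := by ext <;> simp
  comp_one a := by ext <;> simp
  inv_comp a := by ext <;> simp
  comp_inv a := by ext <;> simp
  base c := c.base
  zero y := ⟨y, A.zero (i y), by simp⟩
  add c d h := ⟨c.base, A.add c.cell d.cell (by simp [h]), by simp⟩
  neg c := ⟨c.base, A.neg c.cell, by simp⟩
  base_zero _ := rfl
  base_add _ _ _ := rfl
  base_neg _ := rfl
  add_assoc c d e h₁ h₂ := by ext <;> simp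
  zero_add c := by ext <;> simp
  add_zero c := by ext <;> simp
  neg_add c := by ext <;> simp
  add_neg c := by ext <;> simp
  act c a h := ⟨a.tgt, A.act c.cell a.arr (by simp [h]), by simp⟩
  base_act _ _ _ := rfl
  act_add c d a h h' := by ext <;> simp
  act_comp c a b h h' := by ext <;> simp
  act_one c := by ext <;> simp
  bd c := ⟨c.base, c.base, A.bd c.cell, by simp, by simp⟩
  src_bd _ := rfl
  tgt_bd _ := rfl
  bd_add c d h := by ext <;> simp [h]
  bd_act c a h := by ext <;> simp
  act_bd c d h := by ext <;> simp [act_bd']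

/-! ### Bimorphisms and braided regular crossed modules -/

/-- The maps `b i j : A i × A j → A (i + j)` underlying a monoid bimorphism `A, A → A`
(`b 0 0` being the multiplication of the monoid `A 0`), with their sources, targets and bases.
`lArr x a = x.a`, `rArr a y = a.y`, `lCell x c = x.c`, `rCell c y = c.y`, `braid a b = {a, b}`. -/
structure Bimorphism (A : XMod.{u, v, w}) [Monoid A.Ob] where
  lArr : A.Ob → A.Arr → A.Arr
  rArr : A.Arr → A.Ob → A.Arr
  lCell : A.Ob → A.Cell → A.Cell
  rCell : A.Cell → A.Ob → A.Cell
  braid : A.Arr → A.Arr → A.Cell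
  src_lArr : ∀ x a, A.src (lArr x a) = x * A.src a
  tgt_lArr : ∀ x a, A.tgt (lArr x a) = x * A.tgt a
  src_rArr : ∀ a y, A.src (rArr a y) = A.src a * y
  tgt_rArr : ∀ a y, A.tgt (rArr a y) = A.tgt a * y
  base_lCell : ∀ x c, A.base (lCell x c) = x * A.base c
  base_rCell : ∀ c y, A.base (rCell c y) = A.base c * y
  base_braid : ∀ a b, A.base (braid a b) = A.tgt a * A.tgt b

attribute [simp] Bimorphism.src_lArr Bimorphism.tgt_lArr Bimorphism.src_rArr Bimorphism.tgt_rArr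
  Bimorphism.base_lCell Bimorphism.base_rCell Bimorphism.base_braid

/-- The axioms of a monoid bimorphism, which make `A` a braided semiregular crossed module
(regular, when the monoid of objects is a group). The proofs `h`, `h'`, `h''` that the partial
operations are defined exist by the preceding axioms. -/
structure Bimorphism.IsBraided {A : XMod.{u, v, w}} [Monoid A.Ob] (b : Bimorphism A) : Prop where
  -- commuting left and right actions of the monoid of objects on arrows
  one_lArr : ∀ a, b.lArr 1 a = a
  mul_lArr : ∀ x y a, b.lArr (x * y) a = b.lArr x (b.lArr y a)
  rArr_one : ∀ a, b.rArr a 1 = a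
  rArr_mul : ∀ a x y, b.rArr a (x * y) = b.rArr (b.rArr a x) y
  lArr_rArr : ∀ x a y, b.lArr x (b.rArr a y) = b.rArr (b.lArr x a) y
  lArr_comp : ∀ x a a' h h',
    b.lArr x (A.comp a a' h) = A.comp (b.lArr x a) (b.lArr x a') h'
  rArr_comp : ∀ a a' y h h',
    b.rArr (A.comp a a' h) y = A.comp (b.rArr a y) (b.rArr a' y) h'
  -- commuting left and right actions on two-dimensional elements
  one_lCell : ∀ c, b.lCell 1 c = c
  mul_lCell : ∀ x y c, b.lCell (x * y) c = b.lCell x (b.lCell y c)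
  rCell_one : ∀ c, b.rCell c 1 = c
  rCell_mul : ∀ c x y, b.rCell c (x * y) = b.rCell (b.rCell c x) y
  lCell_rCell : ∀ x c y, b.lCell x (b.rCell c y) = b.rCell (b.lCell x c) y
  lCell_add : ∀ x c c' h h',
    b.lCell x (A.add c c' h) = A.add (b.lCell x c) (b.lCell x c') h'
  rCell_add : ∀ c c' y h h',
    b.rCell (A.add c c' h) y = A.add (b.rCell c y) (b.rCell c' y) h'
  -- compatibility with the action of arrows and with the boundary
  lCell_act : ∀ x c a h h', b.lCell x (A.act c a h) = A.act (b.lCell x c) (b.lArr x a) h'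
  rCell_act : ∀ c a y h h', b.rCell (A.act c a h) y = A.act (b.rCell c y) (b.rArr a y) h'
  bd_lCell : ∀ x c, A.bd (b.lCell x c) = b.lArr x (A.bd c)
  bd_rCell : ∀ c y, A.bd (b.rCell c y) = b.rArr (A.bd c) y
  -- the braiding
  braid_one_left : ∀ a, b.braid (A.one 1) a = A.zero (A.tgt a)
  braid_one_right : ∀ a, b.braid a (A.one 1) = A.zero (A.tgt a)
  braid_comp_right : ∀ a a' a'' h h' h'',
    b.braid a (A.comp a' a'' h) =
      A.add (A.act (b.braid a a') (b.lArr (A.tgt a) a'') h') (b.braid a a'') h''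
  braid_comp_left : ∀ a a' a'' h h' h'',
    b.braid (A.comp a a' h) a'' =
      A.add (b.braid a' a'') (A.act (b.braid a a'') (b.rArr a' (A.tgt a'')) h') h''
  bd_braid : ∀ a a' h h' h'',
    A.bd (b.braid a a') =
      A.comp (A.comp (A.comp (A.inv (b.lArr (A.tgt a) a')) (A.inv (b.rArr a (A.src a'))) h)
        (b.lArr (A.src a) a') h') (b.rArr a (A.tgt a')) h''
  braid_bd_right : ∀ a c h h',
    b.braid a (A.bd c) =
      A.add (A.neg (b.lCell (A.tgt a) c))
        (A.act (b.lCell (A.src a) c) (b.rArr a (A.base c)) h) h'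
  braid_bd_left : ∀ c a h h',
    b.braid (A.bd c) a =
      A.add (A.neg (A.act (b.rCell c (A.src a)) (b.lArr (A.base c) a) h))
        (b.rCell c (A.tgt a)) h'
  lCell_braid : ∀ x a a', b.lCell x (b.braid a a') = b.braid (b.lArr x a) a'
  rCell_braid : ∀ a a' x, b.rCell (b.braid a a') x = b.braid a (b.rArr a' x)
  braid_rArr : ∀ a x a', b.braid (b.rArr a x) a' = b.braid a (b.lArr x a')

instance (A : XMod.{u, v, w}) {Y : Type u'} [Monoid Y] (i : Y → A.Ob) : Monoid (A.full i).Ob :=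
  inferInstanceAs (Monoid Y)

/-- The restriction of a bimorphism to the full sub-crossed module on a submonoid of the monoid
of objects. -/
def Bimorphism.restrict {A : XMod.{u, v, w}} [Monoid A.Ob] (b : Bimorphism A)
    {Y : Type u'} [Monoid Y] (i : Y →* A.Ob) : Bimorphism (A.full i) where
  lArr (x : Y) (a : FullArr A i) := ⟨x * a.src, x * a.tgt, b.lArr (i x) a.arr, by simp, by simp⟩
  rArr (a : FullArr A i) (y : Y) := ⟨a.src * y, a.tgt * y, b.rArr a.arr (i y), by simp, by simp⟩
  lCell (x : Y) (c : FullCell A i) := ⟨x * c.base, b.lCell (i x) c.cell, by simp⟩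
  rCell (c : FullCell A i) (y : Y) := ⟨c.base * y, b.rCell c.cell (i y), by simp⟩
  braid (a a' : FullArr A i) := ⟨a.tgt * a'.tgt, b.braid a.arr a'.arr, by simp⟩
  src_lArr _ _ := rfl
  tgt_lArr _ _ := rfl
  src_rArr _ _ := rfl
  tgt_rArr _ _ := rfl
  base_lCell _ _ := rfl
  base_rCell _ _ := rfl
  base_braid _ _ := rfl

/-- A braided regular crossed module. -/
structure BraidedRegular where
  A : XMod.{u, v, w}
  [group : Group A.Ob]
  b : Bimorphism A
  isBraided : b.IsBraided

attribute [instance] BraidedRegular.group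

/-- An isomorphism of crossed modules compatible with given bimorphisms. -/
structure Bimorphism.Iso {A : XMod.{u, v, w}} {A' : XMod.{u', v', w'}} [Monoid A.Ob]
    [Monoid A'.Ob] (b : Bimorphism A) (b' : Bimorphism A') where
  hom : Hom A A'
  bijective_f0 : Function.Bijective hom.f0
  bijective_f1 : Function.Bijective hom.f1
  bijective_f2 : Function.Bijective hom.f2
  map_one : hom.f0 1 = 1
  map_mul : ∀ x y, hom.f0 (x * y) = hom.f0 x * hom.f0 y
  map_lArr : ∀ x a, hom.f1 (b.lArr x a) = b'.lArr (hom.f0 x) (hom.f1 a)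
  map_rArr : ∀ a y, hom.f1 (b.rArr a y) = b'.rArr (hom.f1 a) (hom.f0 y)
  map_lCell : ∀ x c, hom.f2 (b.lCell x c) = b'.lCell (hom.f0 x) (hom.f2 c)
  map_rCell : ∀ c y, hom.f2 (b.rCell c y) = b'.rCell (hom.f2 c) (hom.f0 y)
  map_braid : ∀ a a', hom.f2 (b.braid a a') = b'.braid (hom.f1 a) (hom.f1 a')

/-! ### 2-crossed modules -/

/-- The data of a 2-crossed module `L → M → P` of groups: boundaries `d2`, `d1`, right actions
`actLP l p = l ^ p`, `actMP m p = m ^ p`, `actLM l m = l ^ m`, and the Peiffer lifting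
`lift m m' = ⟨m, m'⟩`. -/
structure TwoCrossedData (L : Type u) (M : Type v) (P : Type w) [Group L] [Group M]
    [Group P] where
  d2 : L → M
  d1 : M → P
  actLP : L → P → L
  actMP : M → P → M
  actLM : L → M → L
  lift : M → M → L

/-- The axioms of a 2-crossed module. -/
structure TwoCrossedData.IsTwoCrossed {L : Type u} {M : Type v} {P : Type w} [Group L] [Group M]
    [Group P] (T : TwoCrossedData L M P) : Prop where
  -- a complex of `P`-groups, `P` acting on itself by conjugation
  d2_mul : ∀ l l', T.d2 (l * l') = T.d2 l * T.d2 l'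
  d1_mul : ∀ m m', T.d1 (m * m') = T.d1 m * T.d1 m'
  d1_d2 : ∀ l, T.d1 (T.d2 l) = 1
  actLP_mul : ∀ l l' p, T.actLP (l * l') p = T.actLP l p * T.actLP l' p
  actLP_one : ∀ l, T.actLP l 1 = l
  actLP_actLP : ∀ l p q, T.actLP l (p * q) = T.actLP (T.actLP l p) q
  actMP_mul : ∀ m m' p, T.actMP (m * m') p = T.actMP m p * T.actMP m' p
  actMP_one : ∀ m, T.actMP m 1 = m
  actMP_actMP : ∀ m p q, T.actMP m (p * q) = T.actMP (T.actMP m p) q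
  d2_actLP : ∀ l p, T.d2 (T.actLP l p) = T.actMP (T.d2 l) p
  d1_actMP : ∀ m p, T.d1 (T.actMP m p) = p⁻¹ * T.d1 m * p
  -- `d2 : L → M` is a crossed module
  actLM_mul : ∀ l l' m, T.actLM (l * l') m = T.actLM l m * T.actLM l' m
  actLM_one : ∀ l, T.actLM l 1 = l
  actLM_actLM : ∀ l m n, T.actLM l (m * n) = T.actLM (T.actLM l m) n
  d2_actLM : ∀ l m, T.d2 (T.actLM l m) = m⁻¹ * T.d2 l * m
  actLM_d2 : ∀ l l', T.actLM l (T.d2 l') = l'⁻¹ * l * l'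
  actLM_actLP : ∀ l m p, T.actLP (T.actLM l m) p = T.actLM (T.actLP l p) (T.actMP m p)
  -- the axioms of the Peiffer lifting
  d2_lift : ∀ m n, T.d2 (T.lift m n) = m⁻¹ * n⁻¹ * m * T.actMP n (T.d1 m)
  lift_d2_left : ∀ l m, T.lift (T.d2 l) m = l⁻¹ * T.actLM l m
  lift_d2_right : ∀ m l, T.lift m (T.d2 l) = (T.actLM l m)⁻¹ * T.actLP l (T.d1 m)
  lift_mul_right : ∀ m n n',
    T.lift m (n * n') = T.lift m n' * T.actLM (T.lift m n) (T.actMP n' (T.d1 m))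
  lift_mul_left : ∀ m m' n,
    T.lift (m * m') n = T.actLM (T.lift m n) m' * T.lift m' (T.actMP n (T.d1 m))
  lift_actLP : ∀ m n p, T.actLP (T.lift m n) p = T.lift (T.actMP m p) (T.actMP n p)

/-- An isomorphism of 2-crossed modules. -/
structure TwoCrossedData.Iso {L : Type u} {M : Type v} {P : Type w} [Group L] [Group M] [Group P]
    {L' : Type u'} {M' : Type v'} {P' : Type w'} [Group L'] [Group M'] [Group P']
    (T : TwoCrossedData L M P) (T' : TwoCrossedData L' M' P') where
  isoL : L ≃* L'
  isoM : M ≃* M'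
  isoP : P ≃* P'
  map_d2 : ∀ l, isoM (T.d2 l) = T'.d2 (isoL l)
  map_d1 : ∀ m, isoP (T.d1 m) = T'.d1 (isoM m)
  map_actLP : ∀ l p, isoL (T.actLP l p) = T'.actLP (isoL l) (isoP p)
  map_actMP : ∀ m p, isoM (T.actMP m p) = T'.actMP (isoM m) (isoP p)
  map_actLM : ∀ l m, isoL (T.actLM l m) = T'.actLM (isoL l) (isoM m)
  map_lift : ∀ m n, isoL (T.lift m n) = T'.lift (isoM m) (isoM n)

/-! ### From braided regular crossed modules to 2-crossed modules -/

/-- The vertex group `A₂(x)`. -/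
@[ext]
structure Vertex (A : XMod.{u, v, w}) (x : A.Ob) where
  cell : A.Cell
  base_cell : A.base cell = x

attribute [simp] Vertex.base_cell

instance (A : XMod.{u, v, w}) (x : A.Ob) : Mul (Vertex A x) :=
  ⟨fun c d => ⟨A.add c.cell d.cell (by simp), by simp⟩⟩
instance (A : XMod.{u, v, w}) (x : A.Ob) : One (Vertex A x) := ⟨⟨A.zero x, by simp⟩⟩
instance (A : XMod.{u, v, w}) (x : A.Ob) : Inv (Vertex A x) :=
  ⟨fun c => ⟨A.neg c.cell, by simp⟩⟩

section
variable {A : XMod.{u, v, w}} {x : A.Ob}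
@[simp] theorem Vertex.cell_mul (c d : Vertex A x) :
    (c * d).cell = A.add c.cell d.cell (by simp) := rfl
@[simp] theorem Vertex.cell_one : (1 : Vertex A x).cell = A.zero x := rfl
@[simp] theorem Vertex.cell_inv (c : Vertex A x) : c⁻¹.cell = A.neg c.cell := rfl
end

instance (A : XMod.{u, v, w}) (x : A.Ob) : Group (Vertex A x) where
  mul_assoc a b c := by ext; simp
  one_mul a := by ext; simp
  mul_one a := by ext; simp
  inv_mul_cancel a := by ext; simp

namespace BraidedRegular

/-- The costar `K` of the groupoid of arrows at the identity object: the arrows with target `1`. -/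
@[ext]
structure Costar (R : BraidedRegular.{u, v, w}) where
  arr : R.A.Arr
  tgt_arr : R.A.tgt arr = 1

attribute [simp] Costar.tgt_arr

variable (R : BraidedRegular.{u, v, w})

/-- The product of the costar: `a b = a.(α b) + b`. -/
instance : Mul (Costar R) :=
  ⟨fun a b => ⟨R.A.comp (R.b.rArr a.arr (R.A.src b.arr)) b.arr (by simp), by simp⟩⟩
instance : One (Costar R) := ⟨⟨R.A.one 1, by simp⟩⟩
instance : Inv (Costar R) :=
  ⟨fun a => ⟨R.b.rArr (R.A.inv a.arr) (R.A.src a.arr)⁻¹, by simp⟩⟩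

section
variable {R}
@[simp] theorem Costar.arr_mul (a b : Costar R) :
    (a * b).arr = R.A.comp (R.b.rArr a.arr (R.A.src b.arr)) b.arr (by simp) := rfl
@[simp] theorem Costar.arr_one : (1 : Costar R).arr = R.A.one 1 := rfl
@[simp] theorem Costar.arr_inv (a : Costar R) :
    a⁻¹.arr = R.b.rArr (R.A.inv a.arr) (R.A.src a.arr)⁻¹ := rfl
theorem rArr_one_arr (x y : R.A.Ob) : R.b.rArr (R.A.one x) y = R.A.one (x * y) := by
  have h := R.isBraided.rArr_comp (R.A.one x) (R.A.one x) y (by simp) (by simp)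
  refine R.A.comp_left_cancel (a := R.b.rArr (R.A.one x) y) (by simp) (by simp) ?_
  rw [← h]; simp
end

instance : Group (Costar R) where
  mul_assoc a b c := by
    ext
    have e := R.isBraided.rArr_comp (R.b.rArr a.arr (R.A.src b.arr)) b.arr (R.A.src c.arr)
      (by simp) (by simp)
    simp [R.isBraided.rArr_mul, e]
  one_mul a := by ext; simp [rArr_one_arr]
  mul_one a := by ext; simp [R.isBraided.rArr_one]
  inv_mul_cancel a := by
    ext
    simp [← R.isBraided.rArr_mul, R.isBraided.rArr_one]

/-- The 2-crossed module `A₂(1) → K → A₀` of a braided regular crossed module, with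
`α : K → A₀`, the diagonal actions `p⁻¹.z.p` of `A₀`, the action `c ! a = (c.(α a)) ^ a` of `K`
and the Peiffer lifting `⟨a, b⟩ = {a⁻¹, b} ! a`. -/
def toTwoCrossed : TwoCrossedData (Vertex R.A 1) (Costar R) R.A.Ob where
  d2 c := ⟨R.A.bd c.cell, by simp⟩
  d1 a := R.A.src a.arr
  actLP c p := ⟨R.b.rCell (R.b.lCell p⁻¹ c.cell) p, by simp⟩
  actMP a p := ⟨R.b.rArr (R.b.lArr p⁻¹ a.arr) p, by simp⟩
  actLM c a := ⟨R.A.act (R.b.rCell c.cell (R.A.src a.arr)) a.arr (by simp), by simp⟩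
  lift a b := ⟨R.A.act (R.b.rCell (R.b.braid a⁻¹.arr b.arr) (R.A.src a.arr)) a.arr
    (by simp [-Costar.arr_inv]), by simp⟩

end BraidedRegular

/-! ### From 2-crossed modules to braided regular crossed modules -/

section OfTwoCrossed

variable {L : Type u} {M : Type v} {P : Type w} [Group L] [Group M] [Group P]

/-- The crossed module associated with a 2-crossed module: objects `P`, arrows `M × P` with
`α (g, p) = ∂ g * p` and `β (g, p) = p`, and two-dimensional elements `L × P`. -/
def ofTwoCrossed (T : TwoCrossedData L M P) (hT : T.IsTwoCrossed) : XMod where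
  Ob := P
  Arr := M × P
  Cell := L × P
  src a := T.d1 a.1 * a.2
  tgt a := a.2
  one p := (1, p)
  comp a b _ := (a.1 * b.1, b.2)
  inv a := (a.1⁻¹, T.d1 a.1 * a.2)
  src_one := by have := hT.d1_mul 1 1; simp_all
  tgt_one _ := rfl
  src_comp a b h := by simp only [hT.d1_mul, mul_assoc] at *; rw [h]
  tgt_comp _ _ _ := rfl
  src_inv a := by
    have h1 : T.d1 1 = 1 := by have := hT.d1_mul 1 1; simp_all
    simp [← mul_assoc, ← hT.d1_mul, h1]
  tgt_inv _ := rfl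
  comp_assoc a b c _ _ := by simp [mul_assoc]
  one_comp a := by simp
  comp_one a := by simp
  inv_comp a := by simp
  comp_inv a := by simp
  base c := c.2
  zero p := (1, p)
  add c d _ := (c.1 * d.1, c.2)
  neg c := (c.1⁻¹, c.2)
  base_zero _ := rfl
  base_add _ _ _ := rfl
  base_neg _ := rfl
  add_assoc c d e _ _ := by simp [mul_assoc]
  zero_add c := by simp
  add_zero c := by simp
  neg_add c := by simp
  add_neg c := by simp
  act c a _ := (T.actLM c.1 a.1, a.2)
  base_act _ _ _ := rfl
  act_add c d a _ _ := by simp [hT.actLM_mul]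
  act_comp c a b _ _ := by simp [hT.actLM_actLM]
  act_one c := by simp [hT.actLM_one]
  bd c := (T.d2 c.1, c.2)
  src_bd c := by simp [hT.d1_d2]
  tgt_bd _ := rfl
  bd_add c d h := by simp_all [hT.d2_mul]
  bd_act c a _ := by simp [hT.d2_actLM]
  act_bd c d h := by simp_all [hT.actLM_d2]

instance (T : TwoCrossedData L M P) (hT : T.IsTwoCrossed) : Group (ofTwoCrossed T hT).Ob :=
  inferInstanceAs (Group P)

/-- The biaction and the braiding on the crossed module associated with a 2-crossed module. -/
def ofTwoCrossedBimorphism (T : TwoCrossedData L M P) (hT : T.IsTwoCrossed) :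
    Bimorphism (ofTwoCrossed T hT) where
  lArr (p : P) a := (T.actMP a.1 p⁻¹, p * a.2)
  rArr a (p : P) := (a.1, a.2 * p)
  lCell (p : P) c := (T.actLP c.1 p⁻¹, p * c.2)
  rCell c (p : P) := (c.1, c.2 * p)
  braid a b := (T.actLM (T.lift a.1⁻¹ (T.actMP b.1 a.2⁻¹)) a.1, a.2 * b.2)
  src_lArr (p : P) a := show T.d1 (T.actMP a.1 p⁻¹) * (p * a.2) = p * (T.d1 a.1 * a.2) by
    simp [hT.d1_actMP, mul_assoc]
  tgt_lArr _ _ := rfl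
  src_rArr a (p : P) := show T.d1 a.1 * (a.2 * p) = T.d1 a.1 * a.2 * p by rw [mul_assoc]
  tgt_rArr _ _ := rfl
  base_lCell _ _ := rfl
  base_rCell _ _ := rfl
  base_braid _ _ := rfl

end OfTwoCrossed

end XMod

namespace XMod

/-! ### `END(C)` and `AUT(C)` -/

namespace Homotopy

variable {C : XMod.{u, v, w}} {D : XMod.{u', v', w'}} {E : XMod.{u'', v'', w''}}

/-- The homotopy `(f s₀, f s₁)` on `f g`. -/
@[simps]
def lwhisker (f : Hom D E) {g : Hom C D} (s : Homotopy g) : Homotopy (f.comp g) where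
  s0 x := f.f1 (s.s0 x)
  s1 a := f.f2 (s.s1 a)
  tgt_s0 x := by simp
  base_s1 a := by simp
  s1_comp a b h := by simp

/-- The homotopy `(s₀ f, s₁ f)` on `g f`. -/
@[simps]
def rwhisker {g : Hom D E} (s : Homotopy g) (f : Hom C D) : Homotopy (g.comp f) where
  s0 x := s.s0 (f.f0 x)
  s1 a := s.s1 (f.f1 a)
  tgt_s0 x := by simp
  base_s1 a := by simp
  s1_comp a b h := by simp

theorem source_lwhisker (f : Hom D E) {g : Hom C D} (s : Homotopy g) :
    (s.lwhisker f).source = f.comp s.source := by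
  ext <;> simp

theorem source_rwhisker {g : Hom D E} (s : Homotopy g) (f : Hom C D) :
    (s.rwhisker f).source = s.source.comp f := by
  ext <;> simp

end Homotopy

section

variable (C : XMod.{u, v, w})

/-- The crossed module `END(C)`, the internal hom from `C` to itself. -/
abbrev END := CMOD C C

/-- The objects of `END(C)` form a monoid under composition of endomorphisms. -/
instance : Monoid (END C).Ob := inferInstanceAs (Monoid (Hom C C))

/-- The bimorphism on `END(C)` given by the composition of the internal hom:
`(f₁, f₂) ↦ f₁ f₂` on objects and
`f₁.(s₀, s₁, f) = (f₁ s₀, f₁ s₁, f₁ f)`, `(s₀, s₁, f).f₂ = (s₀ f₂, s₁ f₂, f f₂)`,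
`f₁.(s₂, f) = (f₁ s₂, f₁ f)`, `(s₂, f).f₂ = (s₂ f₂, f f₂)`,
`{(s₀, s₁, f), (t₀, t₁, f')} = (s₁ t₀, f f')`.
In each degree this is evaluation of the second argument followed by evaluation of the first. -/
def endBimorphism : Bimorphism (END C) where
  lArr (f : Hom C C) (a : HomArr C C) := ⟨f * a.g, a.s.lwhisker f⟩
  rArr (a : HomArr C C) (f : Hom C C) := ⟨a.g * f, a.s.rwhisker f⟩
  lCell (f : Hom C C) (c : HomSec C C) := ⟨f * c.f, fun x => f.f2 (c.s2 x), by simp⟩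
  rCell (c : HomSec C C) (f : Hom C C) := ⟨c.f * f, fun x => c.s2 (f.f0 x), by simp⟩
  braid (a b : HomArr C C) := ⟨a.g * b.g, fun x => a.s.s1 (b.s.s0 x), by simp⟩
  src_lArr (f : Hom C C) (a : HomArr C C) := Homotopy.source_lwhisker f a.s
  tgt_lArr _ _ := rfl
  src_rArr (a : HomArr C C) (f : Hom C C) := Homotopy.source_rwhisker a.s f
  tgt_rArr _ _ := rfl
  base_lCell _ _ := rfl
  base_rCell _ _ := rfl
  base_braid _ _ := rfl

/-- The inclusion of the group `Aut(C)` in the monoid of objects of `END(C)`. -/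
def autIncl : Aut C →* (END C).Ob := Units.coeHom (Hom C C)

/-- The crossed module `AUT(C)`: the full sub-crossed module of `END(C)` on the automorphisms. -/
def AUT : XMod := (END C).full (autIncl C)

instance : Group (AUT C).Ob := inferInstanceAs (Group (Aut C))

/-- The bimorphism on `AUT(C)` inherited from `END(C)`. -/
def autBimorphism : Bimorphism (AUT C) := (endBimorphism C).restrict (autIncl C)

end

/-! ### Free derivations -/

/-- A free derivation on `C`: a homotopy on the identity morphism. -/
def FDer (C : XMod.{u, v, w}) := Homotopy (1 : Hom C C)

namespace FDer

variable {C : XMod.{u, v, w}}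

/-- The section `s₀` of a free derivation. -/
def s0 (s : FDer C) : C.Ob → C.Arr := Homotopy.s0 s
/-- The derivation `s₁` of a free derivation. -/
def s1 (s : FDer C) : C.Arr → C.Cell := Homotopy.s1 s

/-- `Δ s`, the source of the homotopy `(s, 1) : Δ s ≃ 1`. -/
def Δ (s : FDer C) : Hom C C := Homotopy.source s

@[simp] theorem tgt_s0 (s : FDer C) (x : C.Ob) : C.tgt (s.s0 x) = x := Homotopy.tgt_s0 s x
@[simp] theorem base_s1 (s : FDer C) (a : C.Arr) : C.base (s.s1 a) = C.tgt a :=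
  Homotopy.base_s1 s a
@[simp] theorem s1_comp (s : FDer C) (a b : C.Arr) (h : C.tgt a = C.src b) :
    s.s1 (C.comp a b h) = C.add (C.act (s.s1 a) b (by simp [h])) (s.s1 b) (by simp) :=
  Homotopy.s1_comp s a b h

/-- A free derivation from its components. -/
def mk (s0 : C.Ob → C.Arr) (s1 : C.Arr → C.Cell) (h0 : ∀ x, C.tgt (s0 x) = x)
    (h1 : ∀ a, C.base (s1 a) = C.tgt a)
    (h : ∀ a b (h : C.tgt a = C.src b),
      s1 (C.comp a b h) = C.add (C.act (s1 a) b (by rw [h1, h])) (s1 b)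
        (by rw [base_act, h1])) : FDer C :=
  ⟨s0, s1, h0, h1, h⟩

@[simp] theorem s0_mk (s0 : C.Ob → C.Arr) (s1 : C.Arr → C.Cell) (h0 h1 h) :
    (mk s0 s1 h0 h1 h).s0 = s0 := rfl
@[simp] theorem s1_mk (s0 : C.Ob → C.Arr) (s1 : C.Arr → C.Cell) (h0 h1 h) :
    (mk s0 s1 h0 h1 h).s1 = s1 := rfl

@[ext] theorem ext {s t : FDer C} (h0 : ∀ x, s.s0 x = t.s0 x) (h1 : ∀ a, s.s1 a = t.s1 a) :
    s = t :=
  Homotopy.ext (funext h0) (funext h1)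

@[simp] theorem Δ_f0 (s : FDer C) (x : C.Ob) : s.Δ.f0 x = C.src (s.s0 x) := rfl
theorem Δ_f1 (s : FDer C) (a : C.Arr) :
    s.Δ.f1 a = C.comp (s.s0 (C.src a)) (C.comp a (C.comp (C.bd (s.s1 a))
      (C.inv (s.s0 (C.tgt a))) (by simp)) (by simp)) (by simp) := rfl
theorem Δ_f2 (s : FDer C) (c : C.Cell) :
    s.Δ.f2 c = C.act (C.add c (s.s1 (C.bd c)) (by simp)) (C.inv (s.s0 (C.base c))) (by simp) :=
  rfl

@[simp] theorem s1_one (s : FDer C) (x : C.Ob) : s.s1 (C.one x) = C.zero x :=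
  Homotopy.s1_one s x

/-- The product `s * t` of free derivations: with `g = Δ t`,
`(s * t)₀ x = s₀ (g₀ x) + t₀ x` and `(s * t)₁ a = t₁ a + (s₁ (g₁ a)) ^ t₀ (β a)`. -/
instance : Mul (FDer C) where
  mul s t := mk
    (fun x => C.comp (s.s0 (t.Δ.f0 x)) (t.s0 x) (by simp))
    (fun a => C.add (t.s1 a) (C.act (s.s1 (t.Δ.f1 a)) (t.s0 (C.tgt a)) (by simp)) (by simp))
    (fun x => by simp) (fun a => by simp)
    (Homotopy.trans t (Homotopy.copy (Homotopy.rwhisker s t.Δ) (one_mul t.Δ))).s1_comp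

instance : One (FDer C) where
  one := mk C.one (fun a => C.zero (C.tgt a)) (by simp) (by simp) (by simp)

@[simp] theorem mul_s0 (s t : FDer C) (x : C.Ob) :
    (s * t).s0 x = C.comp (s.s0 (C.src (t.s0 x))) (t.s0 x) (by simp) := rfl
@[simp] theorem mul_s1 (s t : FDer C) (a : C.Arr) :
    (s * t).s1 a = C.add (t.s1 a)
      (C.act (s.s1 (t.Δ.f1 a)) (t.s0 (C.tgt a)) (by simp)) (by simp) := rfl
@[simp] theorem one_s0 (x : C.Ob) : (1 : FDer C).s0 x = C.one x := rfl
@[simp] theorem one_s1 (a : C.Arr) : (1 : FDer C).s1 a = C.zero (C.tgt a) := rfl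

@[simp] theorem Δ_mul (s t : FDer C) : (s * t).Δ = s.Δ * t.Δ :=
  (Homotopy.source_trans t (Homotopy.copy (Homotopy.rwhisker s t.Δ) (one_mul t.Δ))).trans
    ((Homotopy.source_copy _ _).trans (Homotopy.source_rwhisker s t.Δ))

@[simp] theorem Δ_one : (1 : FDer C).Δ = 1 := by
  apply Hom.ext <;> funext x <;> simp [Δ_f1, Δ_f2]

/-- The monoid `FDer(C)`. -/
instance : Monoid (FDer C) where
  mul_assoc r s t := by
    ext
    · simp
    · simp
  one_mul s := by ext <;> simp
  mul_one s := by ext <;> simp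

end FDer

/-! ### Sections and derivations -/

/-- A section of the target map of the groupoid `G`. -/
@[ext]
structure Sect (C : XMod.{u, v, w}) where
  s0 : C.Ob → C.Arr
  tgt_s0 : ∀ x, C.tgt (s0 x) = x

attribute [simp] Sect.tgt_s0

section

variable {C : XMod.{u, v, w}}

/-- The product `(s₀ * t₀) x = s₀ (α (t₀ x)) + t₀ x`. -/
instance : Mul (Sect C) where
  mul s t := ⟨fun x => C.comp (s.s0 (C.src (t.s0 x))) (t.s0 x) (by simp), by simp⟩

instance : One (Sect C) where
  one := ⟨C.one, by simp⟩

@[simp] theorem Sect.mul_s0 (s t : Sect C) (x : C.Ob) :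
    (s * t).s0 x = C.comp (s.s0 (C.src (t.s0 x))) (t.s0 x) (by simp) := rfl
@[simp] theorem Sect.one_s0 (x : C.Ob) : (1 : Sect C).s0 x = C.one x := rfl

/-- The monoid of sections; its group of units is the group `M(G)` of coadmissible sections. -/
instance : Monoid (Sect C) where
  mul_assoc r s t := by ext; simp
  one_mul s := by ext; simp
  mul_one s := by ext; simp

/-- The homomorphism `(s₀, s₁) ↦ s₀`. -/
def FDer.toSect : FDer C →* Sect C where
  toFun s := ⟨s.s0, s.tgt_s0⟩
  map_one' := rfl
  map_mul' _ _ := rfl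

/-- The homomorphism `s₀ ↦ (s₀, 0)`. -/
def Sect.toFDer : Sect C →* FDer C where
  toFun s := FDer.mk s.s0 (fun a => C.zero (C.tgt a)) s.tgt_s0 (by simp) (by simp)
  map_one' := rfl
  map_mul' s t := by ext <;> simp

variable (C) in
/-- The monoid `Der(C)` of derivations: the free derivations `(s₀, s₁)` with `s₀ x = 1_x`. -/
def Der : Submonoid (FDer C) := MonoidHom.mker FDer.toSect

/-- The free derivation `(1, s₁)` of an invertible free derivation `s = (s₀, s₁)`, as an element of
the group `Der*(C)` of invertible derivations. -/
def derPart (s : (FDer C)ˣ) : (Der C)ˣ :=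
  let σ : (FDer C)ˣ := Units.map Sect.toFDer (Units.map FDer.toSect s)
  have hσ : Units.map FDer.toSect σ = Units.map FDer.toSect s := by ext; rfl
  have h1 : FDer.mk C.one s.val.s1 (by simp) (by simp) (by simp) = (σ⁻¹ * s).val := by
    have h : σ.val * FDer.mk C.one s.val.s1 (by simp) (by simp) (by simp) = s.val := by
      ext x
      · simp; rfl
      · simp [σ, Sect.toFDer]
    rw [Units.val_mul]; exact Units.eq_inv_mul_iff_mul_eq σ |>.mpr h
  have h2 : Units.map FDer.toSect (σ⁻¹ * s) = 1 := by rw [map_mul, map_inv, hσ, inv_mul_cancel]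
  { val := ⟨FDer.mk C.one s.val.s1 (by simp) (by simp) (by simp), rfl⟩
    inv := ⟨(σ⁻¹ * s)⁻¹.val, by
      have h3 := congrArg Units.val (inv_eq_one.mpr h2)
      rw [← map_inv] at h3
      exact h3⟩
    val_inv := Subtype.ext (by simp only [Submonoid.coe_mul, h1]; exact Units.mul_inv _)
    inv_val := Subtype.ext (by simp only [Submonoid.coe_mul, h1]; exact Units.inv_mul _) }

/-! ### The 2-crossed module `M₂(C) → FDer*(C) → Aut(C)` -/

variable (C) in
/-- The group `M₂(C)` of sections `s₂` of `β : C → Ob` under pointwise addition. -/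
@[ext]
structure M2 where
  s2 : C.Ob → C.Cell
  base_s2 : ∀ x, C.base (s2 x) = x

attribute [simp] M2.base_s2

instance : Mul (M2 C) where
  mul s t := ⟨fun x => C.add (s.s2 x) (t.s2 x) (by simp), by simp⟩
instance : One (M2 C) where
  one := ⟨C.zero, by simp⟩
instance : Inv (M2 C) where
  inv s := ⟨fun x => C.neg (s.s2 x), by simp⟩

@[simp] theorem M2.mul_s2 (s t : M2 C) (x : C.Ob) :
    (s * t).s2 x = C.add (s.s2 x) (t.s2 x) (by simp) := rfl
@[simp] theorem M2.one_s2 (x : C.Ob) : (1 : M2 C).s2 x = C.zero x := rfl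
@[simp] theorem M2.inv_s2 (s : M2 C) (x : C.Ob) : (s⁻¹).s2 x = C.neg (s.s2 x) := rfl

instance : Group (M2 C) where
  mul_assoc r s t := by ext; simp
  one_mul s := by ext; simp
  mul_one s := by ext; simp
  inv_mul_cancel s := by ext; simp

/-- `s₂ ↦ (δ s₂, s₁)` with `s₁ a = - (s₂ (α a)) ^ a + s₂ (β a)`. -/
def zetaHom : M2 C →* FDer C where
  toFun s := FDer.mk (fun x => C.bd (s.s2 x))
    (fun a => C.add (C.neg (C.act (s.s2 (C.src a)) a (by simp))) (s.s2 (C.tgt a)) (by simp))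
    (by simp) (by simp) (fun a b h => by simp [h])
  map_one' := by ext <;> simp
  map_mul' s t := by
    ext a
    · simp
    · simp [FDer.Δ_f1, act_bd']

/-- The boundary `ζ : M₂(C) → FDer*(C)`. -/
def zeta : M2 C →* (FDer C)ˣ := zetaHom.toHomUnits

/-- The action `s ^ f = (f⁻¹ s₀ f, f⁻¹ s₁ f)` of an automorphism `f` on free derivations. -/
def FDer.conj (f : Aut C) : FDer C →* FDer C where
  toFun s := FDer.mk (fun x => f⁻¹.val.f1 (s.s0 (f.val.f0 x)))
    (fun a => f⁻¹.val.f2 (s.s1 (f.val.f1 a))) (by simp) (by simp) (fun a b h => by simp)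
  map_one' := by ext <;> simp
  map_mul' s t := by
    ext a
    · simp
    · simp [FDer.Δ_f1]

/-- `Δ : FDer*(C) → Aut(C)`. -/
def deltaAut (s : (FDer C)ˣ) : Aut C where
  val := s.val.Δ
  inv := s⁻¹.val.Δ
  val_inv := by rw [← FDer.Δ_mul, Units.mul_inv, FDer.Δ_one]
  inv_val := by rw [← FDer.Δ_mul, Units.inv_mul, FDer.Δ_one]

variable (C) in
/-- The 2-crossed module `M₂(C) → FDer*(C) → Aut(C)` of a crossed module of groupoids `C`:
`Aut(C)` acts by `s₂ ^ f = f⁻¹ s₂ f` and `(s₀, s₁) ^ f = (f⁻¹ s₀ f, f⁻¹ s₁ f)`, `FDer*(C)` acts by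
`(s₂ ^ t) x = s₂ (α (t₀ x)) ^ (t₀ x)`, and the Peiffer lifting is
`⟨s, t⟩ x = s₁⁻¹ ((s₀⁻¹ * t₀ * s₀) x)`, with `s₁⁻¹` the inverse in `Der*(C)` and `s₀⁻¹ * t₀ * s₀`
formed in the group of coadmissible sections. -/
def actorTwoCrossed : TwoCrossedData (M2 C) (FDer C)ˣ (Aut C) where
  d2 := zeta
  d1 := deltaAut
  actLP s f := ⟨fun x => f⁻¹.val.f2 (s.s2 (f.val.f0 x)), by simp⟩
  actMP s f := Units.map (FDer.conj f) s
  actLM s t := ⟨fun x => C.act (s.s2 (t.val.Δ.f0 x)) (t.val.s0 x) (by simp), by simp⟩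
  lift s t := ⟨fun x => (derPart s)⁻¹.val.val.s1
      (((Units.map FDer.toSect s)⁻¹ * Units.map FDer.toSect t * Units.map FDer.toSect s).val.s0 x),
    by simp [-Units.val_mul]⟩

end

end XMod

/-! ### The braiding on `END C` and its restriction to automorphisms. -/

namespace XMod

/-! The braiding axioms already hold on the internal hom `END C`, before any invertibility is
imposed. Most of them say only that composition of maps is associative, or that morphisms preserve
the operations. Those with content are the laws of homotopies read backwards. The derivation law for
`s₁` is additivity of the braiding in its second argument, the formula for the sum of homotopies is
additivity in the first, and the formulas for the source `f₁ a`, `f₂ c` of a homotopy, solved for `δ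
(s₁ a)` and `s₁ (δ c)`, compute the boundary of a braiding and a braiding with a boundary. All of
this passes to a full sub-crossed module along a monoid homomorphism
(`Bimorphism.IsBraided.restrict`), hence to `AUT C`.

For the 2-crossed module everything rests on rewriting the Peiffer lifting, given through inverses
in two different groups, as `⟨s, t⟩ x = - s₁ (a)` with `a = (t ^ Δ s)₀ x`
(`actorTwoCrossed_lift_s2`). Indeed `s₀⁻¹ * t₀ * s₀` at `x` is `a + δ (s₁ a)`, the image of `a`
under `Δ (1, s₁)`, and the inverse derivation sends that image to `- s₁ a`. In this form bilinearity
of the lifting is the derivation law and the product formula for `s₁`, and the boundary law becomes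
the identity `n m ζ⟨m, n⟩ = m n ^ Δ m` (`mul_mul_zeta_lift`), checked on components.

For the comparison, an arrow of `AUT C` ending at an automorphism `f` is uniquely `(s₀ f, s₁ f, f)`
with `s` an invertible free derivation, and similarly for two-dimensional elements. So the costar at
the identity is `FDer*(C)`, the vertex group is `M₂(C)`, and right translation recovers all of `AUT
C`. The braidings match because `s⁻¹ * s = 1` in degree one reads `s₁⁻¹ (Δ s a) ^ s₀ (β a) = - s₁
a`, with `s₁⁻¹` here the second component of `s⁻¹` (`act_inv_s1`). -/

theorem endBimorphism_isBraided (C : XMod.{u, v, w}) : (endBimorphism C).IsBraided where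
  one_lArr a := rfl
  mul_lArr x y a := rfl
  rArr_one a := rfl
  rArr_mul a x y := rfl
  lArr_rArr x a y := rfl
  lArr_comp (x : Hom C C) (a a' : HomArr C C) h h' := by
    have e : a.g = a'.s.source := h
    refine HomArr.ext' rfl (fun y => x.f1_comp _ _ _) fun y => ?_
    change x.f2 (C.add (a'.s.s1 y) (C.act (a.s.s1 y) (a'.s.s0 (C.tgt y)) (by simp [e])) (by simp)) =
      C.add (x.f2 (a'.s.s1 y))
        (C.act (x.f2 (a.s.s1 y)) (x.f1 (a'.s.s0 (C.tgt y))) (by simp [e])) (by simp)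
    simp
  rArr_comp (a a' : HomArr C C) (y : Hom C C) h h' := by
    have e : a.g = a'.s.source := h
    refine HomArr.ext' rfl (fun _ => rfl) fun b => ?_
    change C.add (a'.s.s1 (y.f1 b))
        (C.act (a.s.s1 (y.f1 b)) (a'.s.s0 (C.tgt (y.f1 b))) (by simp [e])) (by simp) =
      C.add (a'.s.s1 (y.f1 b))
        (C.act (a.s.s1 (y.f1 b)) (a'.s.s0 (y.f0 (C.tgt b))) (by simp [e])) (by simp)
    simp
  one_lCell c := rfl
  mul_lCell x y c := rfl
  rCell_one c := rfl
  rCell_mul c x y := rfl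
  lCell_rCell x c y := rfl
  lCell_add x c c' h h' := HomSec.ext rfl (funext fun y => x.f2_add _ _ _)
  rCell_add c c' y h h' := rfl
  lCell_act x c a h h' := HomSec.ext rfl (funext fun y => x.f2_act _ _ _)
  rCell_act c a y h h' := rfl
  bd_lCell (x : Hom C C) (c : HomSec C C) := by
    refine HomArr.ext' rfl (fun y => (x.f1_bd _).symm) fun y => ?_
    change C.add (C.neg (C.act (x.f2 (c.s2 (C.src y))) (x.f1 (c.f.f1 y)) (by simp)))
        (x.f2 (c.s2 (C.tgt y))) (by simp) =
      x.f2 (C.add (C.neg (C.act (c.s2 (C.src y)) (c.f.f1 y) (by simp))) (c.s2 (C.tgt y)) (by simp))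
    simp
  bd_rCell (c : HomSec C C) (y : Hom C C) := by
    refine HomArr.ext' rfl (fun y => rfl) fun b => ?_
    change C.add (C.neg (C.act (c.s2 (y.f0 (C.src b))) (c.f.f1 (y.f1 b)) (by simp)))
        (c.s2 (y.f0 (C.tgt b))) (by simp) =
      C.add (C.neg (C.act (c.s2 (C.src (y.f1 b))) (c.f.f1 (y.f1 b)) (by simp)))
        (c.s2 (C.tgt (y.f1 b))) (by simp)
    simp
  braid_one_left (a : HomArr C C) := HomSec.ext (one_mul a.g)
    (funext fun x => congrArg C.zero (a.s.tgt_s0 x))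
  braid_one_right a := HomSec.ext (mul_one _) (funext fun y => a.s.s1_one _)
  braid_comp_right a a' a'' h h' h'' := HomSec.ext rfl (funext fun y => a.s.s1_comp _ _ _)
  braid_comp_left (a a' a'' : HomArr C C) h h' h'' := by
    have e : a.g = a'.s.source := h
    refine HomSec.ext rfl (funext fun y => ?_)
    change C.add (a'.s.s1 (a''.s.s0 y))
        (C.act (a.s.s1 (a''.s.s0 y)) (a'.s.s0 (C.tgt (a''.s.s0 y))) (by simp [e])) (by simp) =
      C.add (a'.s.s1 (a''.s.s0 y))
        (C.act (a.s.s1 (a''.s.s0 y)) (a'.s.s0 (a''.g.f0 y)) (by simp [e])) (by simp)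
    simp
  -- On objects this is the formula for `f₁` at the source `f` of `a`, solved for `δ (s₁ a)`. On
  -- arrows, `s₁` is applied to the four-term expression for the source of `a'`: the derivation law
  -- splits it, `Homotopy.s1_inv` treats the final negative term, and the Peiffer rule removes the
  -- actions of boundaries.
  bd_braid (a a' : HomArr C C) h h' h'' := by
    refine HomArr.ext' rfl (fun x => ?_) fun y => ?_
    · change C.bd (a.s.s1 (a'.s.s0 x)) =
        C.comp (C.comp (C.comp (C.inv (a.g.f1 (a'.s.s0 x)))
          (C.inv (a.s.s0 (C.src (a'.s.s0 x)))) (by simp))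
          (a.s.source.f1 (a'.s.s0 x)) (by simp)) (a.s.s0 (a'.g.f0 x)) (by simp)
      simp
    · change C.add (C.neg (C.act (a.s.s1 (a'.s.s0 (C.src y))) (a.g.f1 (a'.g.f1 y)) (by simp)))
          (a.s.s1 (a'.s.s0 (C.tgt y))) (by simp) =
        C.add (a.s.s1 (a'.g.f1 y))
          (C.act (C.add (a.s.source.f2 (a'.s.s1 y))
            (C.act (C.add (C.neg (C.act (a.s.s1 (a'.s.source.f1 y))
                (C.inv (a.s.s0 (C.src (a'.s.s0 (C.tgt y))))) (by simp)))
              (C.act (C.neg (C.act (a.g.f2 (a'.s.s1 y))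
                (C.inv (a.g.f1 (a'.s.s0 (C.tgt y)))) (by simp)))
                (C.inv (a.s.s0 (C.src (a'.s.s0 (C.tgt y))))) (by simp)) (by simp))
              (a.s.source.f1 (a'.s.s0 (C.tgt y))) (by simp)) (by simp))
            (a.s.s0 (a'.g.f0 (C.tgt y))) (by simp)) (by simp)
      simp [act_bd_comp, act_comp_bd_comp, Homotopy.s1_inv]
  -- This is `f₂ c = (g₂ c + s₁ (δ c)) ^ (- s₀ (β c))` solved for `s₁ (δ c)`.
  braid_bd_right (a : HomArr C C) (c : HomSec C C) h h' := by
    refine HomSec.ext rfl (funext fun x => ?_)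
    change a.s.s1 (C.bd (c.s2 x)) = C.add (C.neg (a.g.f2 (c.s2 x)))
      (C.act (a.s.source.f2 (c.s2 x)) (a.s.s0 (c.f.f0 x)) (by simp)) (by simp)
    simp
  braid_bd_left (c : HomSec C C) (a : HomArr C C) h h' := by
    refine HomSec.ext rfl (funext fun x => ?_)
    change C.add (C.neg (C.act (c.s2 (C.src (a.s.s0 x))) (c.f.f1 (a.s.s0 x)) (by simp)))
        (c.s2 (C.tgt (a.s.s0 x))) (by simp) =
      C.add (C.neg (C.act (c.s2 (C.src (a.s.s0 x))) (c.f.f1 (a.s.s0 x)) (by simp)))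
        (c.s2 (a.g.f0 x)) (by simp)
    simp
  lCell_braid x a a' := rfl
  rCell_braid a a' x := rfl
  braid_rArr a x a' := rfl

/-- Each axiom holds separately for the labels, by the monoid laws of `Y`, and for the underlying
elements, by the same axiom in `A`. The two are reconciled by multiplicativity of `i` and by
replacing `i` of a label with the actual end point of the element. -/
theorem Bimorphism.IsBraided.restrict {A : XMod.{u, v, w}} [Monoid A.Ob] {b : Bimorphism A}
    (hb : b.IsBraided) {Y : Type u'} [Monoid Y] (i : Y →* A.Ob) : (b.restrict i).IsBraided where
  one_lArr (a : FullArr A i) := FullArr.ext (one_mul a.src) (one_mul a.tgt)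
    (by change b.lArr (i 1) a.arr = _; rw [map_one, hb.one_lArr])
  mul_lArr (x y : Y) (a : FullArr A i) := FullArr.ext (mul_assoc x y a.src) (mul_assoc x y a.tgt)
    (by change b.lArr (i (x * y)) a.arr = _; rw [map_mul, hb.mul_lArr]; rfl)
  rArr_one (a : FullArr A i) := FullArr.ext (mul_one a.src) (mul_one a.tgt)
    (by change b.rArr a.arr (i 1) = _; rw [map_one, hb.rArr_one])
  rArr_mul (a : FullArr A i) (x y : Y) :=
    FullArr.ext (mul_assoc a.src x y).symm (mul_assoc a.tgt x y).symm
      (by change b.rArr a.arr (i (x * y)) = _; rw [map_mul, hb.rArr_mul]; rfl)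
  lArr_rArr (x : Y) (a : FullArr A i) (y : Y) :=
    FullArr.ext (mul_assoc x a.src y).symm (mul_assoc x a.tgt y).symm (hb.lArr_rArr _ _ _)
  lArr_comp x a a' h h' := FullArr.ext rfl rfl (hb.lArr_comp _ _ _ _ _)
  rArr_comp a a' y h h' := FullArr.ext rfl rfl (hb.rArr_comp _ _ _ _ _)
  one_lCell (c : FullCell A i) := FullCell.ext (one_mul c.base)
    (by change b.lCell (i 1) c.cell = _; rw [map_one, hb.one_lCell])
  mul_lCell (x y : Y) (c : FullCell A i) := FullCell.ext (mul_assoc x y c.base)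
    (by change b.lCell (i (x * y)) c.cell = _; rw [map_mul, hb.mul_lCell]; rfl)
  rCell_one (c : FullCell A i) := FullCell.ext (mul_one c.base)
    (by change b.rCell c.cell (i 1) = _; rw [map_one, hb.rCell_one])
  rCell_mul (c : FullCell A i) (x y : Y) := FullCell.ext (mul_assoc c.base x y).symm
    (by change b.rCell c.cell (i (x * y)) = _; rw [map_mul, hb.rCell_mul]; rfl)
  lCell_rCell (x : Y) (c : FullCell A i) (y : Y) :=
    FullCell.ext (mul_assoc x c.base y).symm (hb.lCell_rCell _ _ _)
  lCell_add x c c' h h' := FullCell.ext rfl (hb.lCell_add _ _ _ _ _)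
  rCell_add c c' y h h' := FullCell.ext rfl (hb.rCell_add _ _ _ _ _)
  lCell_act x c a h h' := FullCell.ext rfl (hb.lCell_act _ _ _ _ _)
  rCell_act c a y h h' := FullCell.ext rfl (hb.rCell_act _ _ _ _ _)
  bd_lCell x c := FullArr.ext rfl rfl (hb.bd_lCell _ _)
  bd_rCell c y := FullArr.ext rfl rfl (hb.bd_rCell _ _)
  braid_one_left (a : FullArr A i) := FullCell.ext (one_mul a.tgt)
    (by change b.braid (A.one (i 1)) a.arr = A.zero (i a.tgt)
        rw [map_one, hb.braid_one_left, a.tgt_arr])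
  braid_one_right (a : FullArr A i) := FullCell.ext (mul_one a.tgt)
    (by change b.braid a.arr (A.one (i 1)) = A.zero (i a.tgt)
        rw [map_one, hb.braid_one_right, a.tgt_arr])
  braid_comp_right (a a' a'' : FullArr A i) h h' h'' := FullCell.ext rfl <| by
    change b.braid a.arr (A.comp a'.arr a''.arr _) =
      A.add (A.act (b.braid a.arr a'.arr) (b.lArr (i a.tgt) a''.arr) _) (b.braid a.arr a''.arr) _
    simp only [← a.tgt_arr]
    exact hb.braid_comp_right _ _ _ _ _ _
  braid_comp_left (a a' a'' : FullArr A i) h h' h'' := FullCell.ext rfl <| by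
    change b.braid (A.comp a.arr a'.arr _) a''.arr =
      A.add (b.braid a'.arr a''.arr) (A.act (b.braid a.arr a''.arr)
        (b.rArr a'.arr (i a''.tgt)) _) _
    simp only [← a''.tgt_arr]
    exact hb.braid_comp_left _ _ _ _ _ _
  bd_braid (a a' : FullArr A i) h h' h'' := FullArr.ext rfl rfl <| by
    change A.bd (b.braid a.arr a'.arr) = A.comp (A.comp (A.comp (A.inv (b.lArr (i a.tgt) a'.arr))
      (A.inv (b.rArr a.arr (i a'.src))) _) (b.lArr (i a.src) a'.arr) _)
      (b.rArr a.arr (i a'.tgt)) _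
    simp only [← FullArr.tgt_arr, ← FullArr.src_arr]
    exact hb.bd_braid _ _ _ _ _
  braid_bd_right (a : FullArr A i) (c : FullCell A i) h h' := FullCell.ext rfl <| by
    change b.braid a.arr (A.bd c.cell) = A.add (A.neg (b.lCell (i a.tgt) c.cell))
      (A.act (b.lCell (i a.src) c.cell) (b.rArr a.arr (i c.base)) _) _
    simp only [← FullArr.tgt_arr, ← FullArr.src_arr, ← FullCell.base_cell]
    exact hb.braid_bd_right _ _ _ _
  braid_bd_left (c : FullCell A i) (a : FullArr A i) h h' := FullCell.ext rfl <| by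
    change b.braid (A.bd c.cell) a.arr = A.add (A.neg (A.act (b.rCell c.cell (i a.src))
      (b.lArr (i c.base) a.arr) _)) (b.rCell c.cell (i a.tgt)) _
    simp only [← FullArr.tgt_arr, ← FullArr.src_arr, ← FullCell.base_cell]
    exact hb.braid_bd_left _ _ _ _
  lCell_braid (x : Y) (a a' : FullArr A i) :=
    FullCell.ext (mul_assoc x a.tgt a'.tgt).symm (hb.lCell_braid _ _ _)
  rCell_braid (a a' : FullArr A i) (x : Y) :=
    FullCell.ext (mul_assoc a.tgt a'.tgt x) (hb.rCell_braid _ _ _)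
  braid_rArr (a : FullArr A i) (x : Y) (a' : FullArr A i) :=
    FullCell.ext (mul_assoc a.tgt x a'.tgt) (hb.braid_rArr _ _ _)

end XMod

/-! ### Inverses of free derivations and the Peiffer lifting. -/

namespace XMod

section

variable {C : XMod.{u, v, w}}

@[simp] theorem deltaAut_val (s : (FDer C)ˣ) : (deltaAut s).val = s.val.Δ := rfl

@[simp] theorem deltaAut_inv_val (s : (FDer C)ˣ) : (deltaAut s)⁻¹.val = s⁻¹.val.Δ := rfl

@[simp] theorem conj_s0 (f : Aut C) (s : FDer C) (x : C.Ob) :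
    (FDer.conj f s).s0 x = f⁻¹.val.f1 (s.s0 (f.val.f0 x)) := rfl

@[simp] theorem conj_s1 (f : Aut C) (s : FDer C) (a : C.Arr) :
    (FDer.conj f s).s1 a = f⁻¹.val.f2 (s.s1 (f.val.f1 a)) := rfl

@[simp] theorem zeta_s0 (c : M2 C) (x : C.Ob) : (zeta c).val.s0 x = C.bd (c.s2 x) := rfl

@[simp] theorem zeta_s1 (c : M2 C) (a : C.Arr) : (zeta c).val.s1 a =
    C.add (C.neg (C.act (c.s2 (C.src a)) a (by simp))) (c.s2 (C.tgt a)) (by simp) := rfl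

theorem comp_s0_inv_mul (s : (FDer C)ˣ) (x : C.Ob) :
    C.comp (s⁻¹.val.s0 (C.src (s.val.s0 x))) (s.val.s0 x) (by simp) = C.one x :=
  congrArg (fun t : FDer C => t.s0 x) s.inv_mul

/-- Cancel `s₀ x` on the right in the degree-zero part of `s⁻¹ * s = 1`. -/
theorem s0_inv_src (s : (FDer C)ˣ) (x : C.Ob) :
    s⁻¹.val.s0 (C.src (s.val.s0 x)) = C.inv (s.val.s0 x) := by
  have h := comp_s0_inv_mul s x
  have h2 : C.comp (C.comp (s⁻¹.val.s0 (C.src (s.val.s0 x))) (s.val.s0 x) (by simp))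
      (C.inv (s.val.s0 x)) (by simp) = C.comp (C.one x) (C.inv (s.val.s0 x)) (by simp) := by
    simp only [h]
  simpa using h2

-- The map `x ↦ α (s₀ x)` is the object map of the automorphism `Δ s`. Since `FDer.Δ_f0` unfolds it
-- during simplification, its invertibility is recorded in unfolded form.
@[simp] theorem src_s0_src_inv_s0 (s : (FDer C)ˣ) (x : C.Ob) :
    C.src (s.val.s0 (C.src (s⁻¹.val.s0 x))) = x :=
  Aut.f0_inv (deltaAut s) x

@[simp] theorem src_inv_s0_src_s0 (s : (FDer C)ˣ) (x : C.Ob) :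
    C.src (s⁻¹.val.s0 (C.src (s.val.s0 x))) = x :=
  Aut.inv_f0 (deltaAut s) x

@[simp] theorem Δ_f1_inv_f1 (s : (FDer C)ˣ) (a : C.Arr) :
    s.val.Δ.f1 (s⁻¹.val.Δ.f1 a) = a :=
  Aut.f1_inv (deltaAut s) a

@[simp] theorem Δ_inv_f1_f1 (s : (FDer C)ˣ) (a : C.Arr) :
    s⁻¹.val.Δ.f1 (s.val.Δ.f1 a) = a :=
  Aut.inv_f1 (deltaAut s) a

@[simp] theorem Δ_f2_inv_f2 (s : (FDer C)ˣ) (c : C.Cell) :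
    s.val.Δ.f2 (s⁻¹.val.Δ.f2 c) = c :=
  Aut.f2_inv (deltaAut s) c

@[simp] theorem Δ_inv_f2_f2 (s : (FDer C)ˣ) (c : C.Cell) :
    s⁻¹.val.Δ.f2 (s.val.Δ.f2 c) = c :=
  Aut.inv_f2 (deltaAut s) c

theorem FDer.s1_inv (s : FDer C) (a : C.Arr) :
    s.s1 (C.inv a) = C.neg (C.act (s.s1 a) (C.inv a) (by simp)) :=
  Homotopy.s1_inv s a

-- The inner terms cancel telescopically on arrows, and on cells by the Peiffer rule. This makes `ζ`
-- followed by `Δ` trivial.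
@[simp] theorem Δ_zeta (c : M2 C) : (zeta c).val.Δ = 1 := by
  apply Hom.ext <;> funext x <;> simp [FDer.Δ_f1, FDer.Δ_f2, act_bd', act_inv_bd]

@[simp] theorem deltaAut_zeta (c : M2 C) : deltaAut (zeta c) = 1 := Units.ext (Δ_zeta c)

/-- The Peiffer lifting is `⟨s, t⟩ x = - s₁ ((t ^ Δ s)₀ x)`. -/
theorem actorTwoCrossed_lift_s2 (s t : (FDer C)ˣ) (x : C.Ob) :
    ((actorTwoCrossed C).lift s t).s2 x =
      C.neg (s.val.s1 ((FDer.conj (deltaAut s) t.val).s0 x)) := by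
  set a := (FDer.conj (deltaAut s) t.val).s0 x with ha
  -- By definition `a` is the preimage under `Δ s` of the arrow `t₀ (Δ s x)`.
  have hga : s.val.Δ.f1 a = t.val.s0 (s.val.Δ.f0 x) := Aut.f1_inv (deltaAut s) _
  have htgt : C.tgt a = x := by simp [a]
  have hb : C.base ((derPart s)⁻¹.val.val.s1 ((derPart s).val.val.Δ.f1 a)) =
      C.src (C.one (C.tgt a)) := by
    rw [FDer.base_s1, Hom.tgt_f1]
    exact C.src_one _ |>.symm ▸ C.src_one _
  have h2 : (derPart s).val.val.s1 a = s.val.s1 a := rfl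
  -- The inverse law in `Der*(C)` evaluated at `a`; since the section part is trivial, the action in
  -- the product formula is by an identity arrow.
  have h1 : C.add ((derPart s).val.val.s1 a)
      (C.act ((derPart s)⁻¹.val.val.s1 ((derPart s).val.val.Δ.f1 a)) (C.one (C.tgt a)) hb)
      (by rw [FDer.base_s1, C.base_act, C.tgt_one]) = C.zero (C.tgt a) :=
    congrArg (fun t : Der C => t.val.s1 a) (derPart s).inv_mul
  -- Conjugating `t₀ (Δ s x) = s₀ (α a) + a + δ (s₁ a) - s₀ x` by `s₀` in `M(G)` strips both outer
  -- terms, leaving `a + δ (s₁ a)`.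
  have h3 : ((Units.map FDer.toSect s)⁻¹ * Units.map FDer.toSect t *
      Units.map FDer.toSect s).val.s0 x
      = (derPart s).val.val.Δ.f1 a := by
    change C.comp (C.comp (s⁻¹.val.s0 (C.src (t.val.s0 (C.src (s.val.s0 x)))))
      (t.val.s0 (C.src (s.val.s0 x))) (by simp)) (s.val.s0 x) (by simp) =
      C.comp (C.one (C.src a)) (C.comp a (C.comp (C.bd (s.val.s1 a)) (C.inv (C.one (C.tgt a)))
        (by simp)) (by simp)) (by simp)
    have h4 : t.val.s0 (C.src (s.val.s0 x)) = s.val.Δ.f1 a := hga.symm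
    simp only [h4, FDer.Δ_f1]
    simp [s0_inv_src, htgt]
  change (derPart s)⁻¹.val.val.s1 _ = _
  rw [h3]
  refine C.add_left_cancel (a := s.val.s1 a) ?_ (by simp) ?_
  · rw [hb]; simp
  · simp only [h2, act_one'] at h1
    rw [h1]; simp

theorem deltaAut_conj (s : (FDer C)ˣ) (p : Aut C) :
    deltaAut (Units.map (FDer.conj p) s) = p⁻¹ * deltaAut s * p := by
  apply Units.ext
  apply Hom.ext <;> funext x <;> simp [FDer.Δ_f1, FDer.Δ_f2]

/-- This is the boundary law of the Peiffer lifting with the inverses cleared. The product `n m`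
differs from `m n ^ Δ m` exactly by the terms in `m₁` that the source formula for `Δ m` introduces,
and `ζ` of the lifting cancels them. -/
theorem mul_mul_zeta_lift (m n : (FDer C)ˣ) :
    n * m * zeta ((actorTwoCrossed C).lift m n) = m * Units.map (FDer.conj (deltaAut m)) n := by
  -- Taking `k = n ^ Δ m` as the variable makes the lifting `- m₁ (k₀ x)` and removes the inverse of
  -- `Δ m` from the components of `n * m`.
  obtain ⟨k, rfl⟩ : ∃ k, n = Units.map (FDer.conj (deltaAut m)⁻¹) k :=
    ⟨Units.map (FDer.conj (deltaAut m)) n, by apply Units.ext; ext <;> simp⟩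
  have hk : FDer.conj (deltaAut m) (FDer.conj (deltaAut m)⁻¹ k.val) = k.val := by ext <;> simp
  have hz (x) : ((actorTwoCrossed C).lift m (Units.map (FDer.conj (deltaAut m)⁻¹) k)).s2 x =
      C.neg (m.val.s1 (k.val.s0 x)) := by
    rw [actorTwoCrossed_lift_s2]
    change C.neg (m.val.s1 ((FDer.conj (deltaAut m) (FDer.conj (deltaAut m)⁻¹ k.val)).s0 x)) = _
    rw [hk]
  generalize (actorTwoCrossed C).lift m (Units.map (FDer.conj (deltaAut m)⁻¹) k) = z at hz
  have h0 (x) : (FDer.conj (deltaAut m)⁻¹ k.val * m.val).s0 x =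
      C.comp (m.val.s0 (C.src (k.val.s0 x))) (C.comp (k.val.s0 x) (C.bd (m.val.s1 (k.val.s0 x))) (by simp)) (by simp) := by
    simp [FDer.Δ_f1]
  have h1 (a) : (FDer.conj (deltaAut m)⁻¹ k.val * m.val).s1 a = C.add (m.val.s1 a)
      (C.add (k.val.s1 a) (m.val.s1 (C.bd (k.val.s1 a))) (by simp)) (by simp) := by
    simp [FDer.Δ_f2]
  apply Units.ext
  change FDer.conj (deltaAut m)⁻¹ k.val * m.val * (zeta z).val =
    m.val * FDer.conj (deltaAut m) (FDer.conj (deltaAut m)⁻¹ k.val)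
  rw [hk]
  -- From here the product is known only through the simplified components `h0` and `h1`.
  generalize FDer.conj (deltaAut m)⁻¹ k.val * m.val = w at h0 h1
  ext a
  · simp only [FDer.mul_s0, h0, zeta_s0, hz, bd_neg]
    simp
  · simp only [FDer.mul_s1, h1, zeta_s0, zeta_s1, Δ_zeta, Hom.one_f1, hz, bd_neg, FDer.Δ_f1]
    simp [act_inv_bd, FDer.s1_inv, act_comp_bd_comp, act_bd']

end

/-! ### The axioms of the 2-crossed module. -/

theorem actorTwoCrossed_isTwoCrossed (C : XMod.{u, v, w}) : (actorTwoCrossed C).IsTwoCrossed where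
  d2_mul := zeta.map_mul
  d1_mul s t := Units.ext (FDer.Δ_mul _ _)
  d1_d2 := deltaAut_zeta
  actLP_mul l l' p := by ext; simp [actorTwoCrossed]
  actLP_one l := rfl
  actLP_actLP l p q := by ext; simp [actorTwoCrossed]
  actMP_mul m m' p := map_mul _ _ _
  actMP_one m := rfl
  actMP_actMP m p q := by ext <;> simp [actorTwoCrossed]
  d2_actLP l p := by
    apply Units.ext
    ext <;> simp [actorTwoCrossed]
  d1_actMP := deltaAut_conj
  actLM_mul l l' m := by ext; simp [actorTwoCrossed]
  actLM_one l := by ext; simp [actorTwoCrossed]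
  actLM_actLM l m n := by ext; simp [actorTwoCrossed]
  d2_actLM l m := by
    -- Moving `m⁻¹` to the other side leaves an identity of products with no inverse derivation to
    -- expand.
    rw [mul_assoc, eq_inv_mul_iff_mul_eq]
    apply Units.ext
    ext
    · simp [actorTwoCrossed]
    · simp [actorTwoCrossed, FDer.Δ_f1, act_comp_bd_comp]
  actLM_d2 l l' := by ext; simp [actorTwoCrossed, act_bd']
  actLM_actLP l m p := by ext; simp [actorTwoCrossed]
  d2_lift m n := by
    have e : m⁻¹ * n⁻¹ * m = (n * m)⁻¹ * m := by group
    rw [e, mul_assoc, eq_inv_mul_iff_mul_eq]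
    exact mul_mul_zeta_lift m n
  lift_d2_left l m := by
    ext x
    rw [actorTwoCrossed_lift_s2]
    change C.neg ((zeta l).val.s1 ((FDer.conj (deltaAut (zeta l)) m.val).s0 x)) =
      C.add (C.neg (l.s2 x)) (C.act (l.s2 (C.src (m.val.s0 x))) (m.val.s0 x) (by simp)) (by simp)
    -- Keeping `deltaAut (zeta l)` folded lets it be replaced by the identity automorphism, so that
    -- the conjugation disappears.
    simp [-deltaAut_val, -deltaAut_inv_val]
  lift_d2_right m l := by
    ext x
    rw [actorTwoCrossed_lift_s2]
    -- With `l₂ (Δ m x)` written as the image of `k` under `Δ m`, the claim is the formula for `Δ m`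
    -- on cells: `(Δ m k) ^ m₀ x = k + m₁ (δ k)`.
    obtain ⟨k, hk⟩ : ∃ k, l.s2 (C.src (m.val.s0 x)) = m.val.Δ.f2 k :=
      ⟨m⁻¹.val.Δ.f2 (l.s2 (C.src (m.val.s0 x))), by simp⟩
    have e : C.base k = x := by
      have e1 := congrArg (fun c => (m⁻¹.val.Δ).f0 (C.base c)) hk
      simpa using e1.symm
    change C.neg (m.val.s1 (m⁻¹.val.Δ.f1 (C.bd (l.s2 (C.src (m.val.s0 x)))))) =
      C.add (C.neg (C.act (l.s2 (C.src (m.val.s0 x))) (m.val.s0 x) (by simp)))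
        (m⁻¹.val.Δ.f2 (l.s2 (C.src (m.val.s0 x)))) (by simp)
    simp only [Hom.f1_bd, hk, Δ_inv_f2_f2]
    simp [FDer.Δ_f2, e]
  lift_mul_right m n n' := by
    ext x
    simp only [M2.mul_s2, actorTwoCrossed_lift_s2]
    change _ = C.add _ (C.act (((actorTwoCrossed C).lift m n).s2
      (C.src ((FDer.conj (deltaAut m) n'.val).s0 x)))
      ((FDer.conj (deltaAut m) n'.val).s0 x) _) _
    -- What remains is the derivation law of `m₁` on the product section.
    simp only [actorTwoCrossed_lift_s2]
    simp
  lift_mul_left m m' n := by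
    ext x
    simp only [M2.mul_s2, actorTwoCrossed_lift_s2]
    change _ = C.add (C.act (((actorTwoCrossed C).lift m n).s2 _) (m'.val.s0 x) _)
      (C.neg (m'.val.s1 (m'⁻¹.val.Δ.f1 (m⁻¹.val.Δ.f1 (n.val.s0 (C.src (m.val.s0 (C.src (m'.val.s0 x))))))))) _
    -- What remains is the product formula for `(m * m')₁`.
    simp only [actorTwoCrossed_lift_s2]
    simp
  lift_actLP m n p := by
    ext x
    rw [actorTwoCrossed_lift_s2]
    change p⁻¹.val.f2 (((actorTwoCrossed C).lift m n).s2 _) = _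
    rw [actorTwoCrossed_lift_s2]
    change _ = C.neg ((FDer.conj p m.val).s1 ((FDer.conj (deltaAut (Units.map (FDer.conj p) m))
      (FDer.conj p n.val)).s0 x))
    rw [deltaAut_conj]
    simp

end XMod

/-! ### From `AUT C` to the 2-crossed module. -/

namespace XMod

section

variable {C : XMod.{u, v, w}} (hA : (autBimorphism C).IsBraided)

variable (C) in
/-- The braided regular crossed module `AUT(C)`. -/
abbrev autBraidedRegular (hA : (autBimorphism C).IsBraided) : BraidedRegular :=
  BraidedRegular.mk (AUT C) (autBimorphism C) hA

theorem costar_g (a : BraidedRegular.Costar (autBraidedRegular C hA)) : a.arr.arr.g = 1 :=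
  a.arr.tgt_arr.trans (congrArg (autIncl C) a.tgt_arr)

/-- The free derivation `(s₀, s₁)` underlying an element `(s₀, s₁, 1)` of the costar of `AUT(C)`. -/
def costarToFDer : BraidedRegular.Costar (autBraidedRegular C hA) →* FDer C where
  toFun a := a.arr.arr.s.copy (costar_g hA a)
  map_one' := rfl
  map_mul' a b := by
    -- The product in the costar translates by the automorphism labelling the source of `b`, the
    -- product of free derivations by `Δ` of `b`; the two are equal but not definitionally.
    have e : b.arr.arr.s.source = (autIncl C) b.arr.src := b.arr.src_arr
    have e0 (x) : ((autIncl C) b.arr.src).f0 x = C.src (b.arr.arr.s.s0 x) := by rw [← e]; rfl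
    have e1 : (autIncl C) b.arr.src = FDer.Δ (b.arr.arr.s.copy (costar_g hA b)) :=
      e.symm.trans (Homotopy.source_copy _ _).symm
    apply FDer.ext
    · intro x
      change C.comp (a.arr.arr.s.s0 (((autIncl C) b.arr.src).f0 x)) (b.arr.arr.s.s0 x) _ =
        C.comp (a.arr.arr.s.s0 (C.src (b.arr.arr.s.s0 x))) (b.arr.arr.s.s0 x) _
      simp only [e0]
    · intro x
      change C.add (b.arr.arr.s.s1 x) (C.act (a.arr.arr.s.s1 (((autIncl C) b.arr.src).f1 x))
          (b.arr.arr.s.s0 (C.tgt x)) _) _ =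
        C.add (b.arr.arr.s.s1 x) (C.act (a.arr.arr.s.s1
          ((FDer.Δ (b.arr.arr.s.copy (costar_g hA b))).f1 x)) (b.arr.arr.s.s0 (C.tgt x)) _) _
      simp only [e1]

/-- The arrow `(s₀ f, s₁ f, f)` of `AUT(C)`, for a free derivation `s` and an automorphism `f`. -/
def autArr (s : (FDer C)ˣ) (f : Aut C) : (AUT C).Arr where
  src := deltaAut s * f
  tgt := f
  arr := ⟨f.val, Homotopy.copy (Homotopy.rwhisker (g := (1 : Hom C C)) s.val f.val) (one_mul f.val)⟩
  src_arr := (Homotopy.source_copy (Homotopy.rwhisker (g := (1 : Hom C C)) s.val f.val)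
    (one_mul f.val)).trans (Homotopy.source_rwhisker (g := (1 : Hom C C)) s.val f.val)
  tgt_arr := rfl

/-- The source label is redundant: it is determined by the source of the homotopy, since an
automorphism is determined by its underlying endomorphism. -/
theorem aut_arr_ext {a b : (AUT C).Arr} (h : a.tgt = b.tgt)
    (h0 : ∀ x, a.arr.s.s0 x = b.arr.s.s0 x) (h1 : ∀ x, a.arr.s.s1 x = b.arr.s.s1 x) : a = b := by
  have e : a.arr = b.arr :=
    HomArr.ext' (a.tgt_arr.trans ((congrArg (autIncl C) h).trans b.tgt_arr.symm)) h0 h1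
  exact FullArr.ext (Units.ext (a.src_arr.symm.trans ((congrArg _ e).trans b.src_arr))) h e

theorem aut_cell_ext {c d : (AUT C).Cell} (h : c.base = d.base)
    (h2 : ∀ x, c.cell.s2 x = d.cell.s2 x) : c = d :=
  FullCell.ext h (HomSec.ext
    (c.base_cell.trans ((congrArg (autIncl C) h).trans d.base_cell.symm)) (funext h2))

variable (C) in
/-- The costar of `AUT(C)` is `FDer*(C)`. -/
def costarEquiv (hA : (autBimorphism C).IsBraided) :
    BraidedRegular.Costar (autBraidedRegular C hA) ≃* (FDer C)ˣ where
  toFun := (costarToFDer hA).toHomUnits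
  invFun s := ⟨autArr s 1, rfl⟩
  left_inv a := BraidedRegular.Costar.ext (aut_arr_ext a.tgt_arr.symm (fun _ => rfl) fun _ => rfl)
  right_inv _ := Units.ext rfl
  map_mul' := map_mul _

variable (C) in
/-- The vertex group of `AUT(C)` at the identity is `M₂(C)`. -/
def vertexEquiv : Vertex (AUT C) 1 ≃* M2 C where
  toFun c := ⟨c.cell.cell.s2, fun x => by
    have e : c.cell.cell.f = 1 := c.cell.base_cell.trans (congrArg (autIncl C) c.base_cell)
    rw [c.cell.cell.base_s2, e]; rfl⟩
  invFun s := ⟨⟨1, ⟨1, s.s2, s.base_s2⟩, rfl⟩, rfl⟩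
  left_inv c := Vertex.ext (aut_cell_ext c.base_cell.symm fun _ => rfl)
  right_inv _ := rfl
  map_mul' c d := rfl

theorem costar_src (a : BraidedRegular.Costar (autBraidedRegular C hA)) :
    a.arr.src = deltaAut (costarEquiv C hA a) :=
  Units.ext (a.arr.src_arr.symm.trans (Homotopy.source_copy a.arr.arr.s (costar_g hA a)).symm)

/-- This is `s⁻¹ * s = 1` in degree one. It turns both braidings into the formula for the lifting.
-/
theorem act_inv_s1 (s : (FDer C)ˣ) (a : C.Arr) :
    C.act (s⁻¹.val.s1 (s.val.Δ.f1 a)) (s.val.s0 (C.tgt a)) (by simp) = C.neg (s.val.s1 a) := by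
  have h := congrArg (fun r : FDer C => r.s1 a) s.inv_mul
  refine C.add_left_cancel (a := s.val.s1 a) (by simp) (by simp) ?_
  simp only [FDer.mul_s1, FDer.one_s1] at h
  rw [h]; simp

theorem vertexEquiv_actLM (c : Vertex (AUT C) 1)
    (a : BraidedRegular.Costar (autBraidedRegular C hA)) (x : C.Ob) :
    (vertexEquiv C ((autBraidedRegular C hA).toTwoCrossed.actLM c a)).s2 x =
      C.act ((vertexEquiv C c).s2 ((costarEquiv C hA a).val.Δ.f0 x)) ((costarEquiv C hA a).val.s0 x)
        (by simp) := by
  change C.act (c.cell.cell.s2 (a.arr.src.val.f0 x)) (a.arr.arr.s.s0 x) _ =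
    C.act (c.cell.cell.s2 ((deltaAut (costarEquiv C hA a)).val.f0 x)) (a.arr.arr.s.s0 x) _
  simp only [costar_src hA a]

/-- The braiding with `a⁻¹`, acted on by `a`, is `s₁⁻¹ (t₀ (Δ s x)) ^ s₀ x`, with `s₁⁻¹` the second
component of `s⁻¹`. Since `t₀ (Δ s x)` is the image of `z = (t ^ Δ s)₀ x` under `Δ s`, `act_inv_s1`
gives `- s₁ z`. -/
theorem vertexEquiv_lift (a b : BraidedRegular.Costar (autBraidedRegular C hA)) :
    vertexEquiv C ((autBraidedRegular C hA).toTwoCrossed.lift a b) =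
      (actorTwoCrossed C).lift (costarEquiv C hA a) (costarEquiv C hA b) := by
  ext x
  rw [actorTwoCrossed_lift_s2]
  set s := costarEquiv C hA a with hs
  set t := costarEquiv C hA b with ht
  have hi : costarEquiv C hA a⁻¹ = s⁻¹ := map_inv _ _
  have e0 : C.base (s⁻¹.val.s1 (t.val.s0 (s.val.Δ.f0 x))) = C.src (s.val.s0 x) := by simp
  have e : (vertexEquiv C ((autBraidedRegular C hA).toTwoCrossed.lift a b)).s2 x =
      C.act (s⁻¹.val.s1 (t.val.s0 (s.val.Δ.f0 x))) (s.val.s0 x) e0 := by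
    simp only [← hi]
    change C.act (a⁻¹.arr.arr.s.s1 (b.arr.arr.s.s0 (a.arr.src.val.f0 x))) (a.arr.arr.s.s0 x) _ =
      C.act (a⁻¹.arr.arr.s.s1 (b.arr.arr.s.s0 ((deltaAut s).val.f0 x))) (a.arr.arr.s.s0 x) _
    simp only [costar_src hA a, ← hs]
  rw [e]
  set z := (FDer.conj (deltaAut s) t.val).s0 x with hz
  have htgt : C.tgt z = x := by simp [z]
  have hga : s.val.Δ.f1 z = t.val.s0 (s.val.Δ.f0 x) := Aut.f1_inv (deltaAut s) _
  rw [← act_inv_s1]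
  simp only [hga, htgt]

variable (C) in
/-- The 2-crossed module associated with `AUT(C)` is `M₂(C) → FDer*(C) → Aut(C)`. -/
def autTwoCrossedIso (hA : (autBimorphism C).IsBraided) :
    (autBraidedRegular C hA).toTwoCrossed.Iso (actorTwoCrossed C) where
  isoL := vertexEquiv C
  isoM := costarEquiv C hA
  isoP := MulEquiv.refl (Aut C)
  map_d2 c := by
    have e : c.cell.cell.f = 1 := c.cell.base_cell.trans (congrArg (autIncl C) c.base_cell)
    apply Units.ext
    apply FDer.ext
    · exact fun x => rfl
    · intro x
      change C.add (C.neg (C.act (c.cell.cell.s2 (C.src x)) (c.cell.cell.f.f1 x) _)) _ _ =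
        C.add (C.neg (C.act (c.cell.cell.s2 (C.src x)) ((1 : Hom C C).f1 x) _)) _ _
      simp only [e]
      rfl
  map_d1 := costar_src hA
  map_actLP l p := rfl
  map_actMP m p := Units.ext rfl
  map_actLM c a := M2.ext (funext (vertexEquiv_actLM hA c a))
  map_lift := vertexEquiv_lift hA

/-! ### From the 2-crossed module back to `AUT C`. -/

variable (C) in
/-- `AUT(C)` is the crossed module associated with `M₂(C) → FDer*(C) → Aut(C)`. -/
def ofActorHom (hT : (actorTwoCrossed C).IsTwoCrossed) :
    Hom (ofTwoCrossed (actorTwoCrossed C) hT) (AUT C) where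
  f0 f := f
  f1 a := autArr a.1 a.2
  f2 c := ⟨c.2, ⟨c.2.val, fun x => c.1.s2 (c.2.val.f0 x), by simp⟩, rfl⟩
  src_f1 _ := rfl
  tgt_f1 _ := rfl
  base_f2 _ := rfl
  f1_comp a b h := by
    obtain ⟨s, f⟩ := a
    obtain ⟨t, k⟩ := b
    -- Composability is this equation of automorphisms; after substitution both sums translate by
    -- the same map.
    obtain rfl : f = deltaAut t * k := h
    refine aut_arr_ext rfl (fun x => rfl) fun x => ?_
    change C.add (t.val.s1 (k.val.f1 x)) (C.act (s.val.s1 (t.val.Δ.f1 (k.val.f1 x)))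
        (t.val.s0 (C.tgt (k.val.f1 x))) _) _ =
      C.add (t.val.s1 (k.val.f1 x)) (C.act (s.val.s1 (t.val.Δ.f1 (k.val.f1 x)))
        (t.val.s0 (k.val.f0 (C.tgt x))) _) _
    simp only [Hom.tgt_f1]
  f2_add c d h := by
    obtain ⟨l, f⟩ := c
    obtain ⟨l', k⟩ := d
    obtain rfl : f = k := h
    rfl
  f1_bd c := by
    refine aut_arr_ext rfl (fun x => rfl) fun x => ?_
    change C.add (C.neg (C.act (c.1.s2 (C.src (c.2.val.f1 x))) (c.2.val.f1 x) _))
        (c.1.s2 (C.tgt (c.2.val.f1 x))) _ =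
      C.add (C.neg (C.act (c.1.s2 (c.2.val.f0 (C.src x))) (c.2.val.f1 x) _))
        (c.1.s2 (c.2.val.f0 (C.tgt x))) _
    simp only [Hom.tgt_f1, Hom.src_f1]
  f2_act c a h := by
    obtain ⟨l, f⟩ := c
    obtain ⟨t, k⟩ := a
    obtain rfl : f = deltaAut t * k := h
    rfl

/-- Precomposition with the bijection `f` loses nothing: evaluate at preimages under `f`. -/
theorem autArr_injective {s t : (FDer C)ˣ} {f k : Aut C} (h : autArr s f = autArr t k) :
    s = t ∧ f = k := by
  obtain rfl : f = k := congrArg FullArr.tgt h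
  refine ⟨Units.ext (FDer.ext (fun x => ?_) fun a => ?_), rfl⟩
  · have e : s.val.s0 (f.val.f0 (f⁻¹.val.f0 x)) = t.val.s0 (f.val.f0 (f⁻¹.val.f0 x)) :=
      congrArg (fun a : FullArr (END C) (autIncl C) => a.arr.s.s0 (f⁻¹.val.f0 x)) h
    simpa using e
  · have e : s.val.s1 (f.val.f1 (f⁻¹.val.f1 a)) = t.val.s1 (f.val.f1 (f⁻¹.val.f1 a)) :=
      congrArg (fun b : FullArr (END C) (autIncl C) => b.arr.s.s1 (f⁻¹.val.f1 a)) h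
    simpa using e

theorem autArr_surjective (hA : (autBimorphism C).IsBraided) (b : (AUT C).Arr) :
    ∃ s, autArr s b.tgt = b := by
  let f : Aut C := b.tgt
  -- Right translation by `f⁻¹` moves the target of `b` to the identity, so the translate is an
  -- element of the costar.
  refine ⟨costarEquiv C hA ⟨(autBimorphism C).rArr b f⁻¹, mul_inv_cancel f⟩,
    aut_arr_ext rfl (fun x => ?_) fun x => ?_⟩
  · exact congrArg b.arr.s.s0 (Aut.inv_f0 f x)
  · exact congrArg b.arr.s.s1 (Aut.inv_f1 f x)

variable (C) in
/-- The isomorphism `ofActorHom` is compatible with the biactions and the braidings. -/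
def ofActorIso (hA : (autBimorphism C).IsBraided) (hT : (actorTwoCrossed C).IsTwoCrossed) :
    (ofTwoCrossedBimorphism (actorTwoCrossed C) hT).Iso (autBimorphism C) where
  hom := ofActorHom C hT
  bijective_f0 := Function.bijective_id
  bijective_f1 := by
    refine ⟨fun a b h => ?_, fun b => ?_⟩
    · exact Prod.ext (autArr_injective h).1 (autArr_injective h).2
    · obtain ⟨s, hs⟩ := autArr_surjective hA b
      exact ⟨(s, b.tgt), hs⟩
  bijective_f2 := by
    refine ⟨fun c d h => ?_, fun c => ?_⟩
    · obtain ⟨l, f⟩ := c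
      obtain ⟨l', k⟩ := d
      obtain rfl : f = k := congrArg FullCell.base h
      refine Prod.ext (M2.ext (funext fun x => ?_)) rfl
      have e : l.s2 (f.val.f0 (f⁻¹.val.f0 x)) = l'.s2 (f.val.f0 (f⁻¹.val.f0 x)) :=
        congrArg (fun c : FullCell (END C) (autIncl C) => c.cell.s2 (f⁻¹.val.f0 x)) h
      simpa using e
    · let f : Aut C := c.base
      have hf : c.cell.f = f.val := c.base_cell
      refine ⟨(⟨fun x => c.cell.s2 (f⁻¹.val.f0 x), fun x => ?_⟩, f), aut_cell_ext rfl fun x => ?_⟩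
      · rw [c.cell.base_s2, hf, Aut.f0_inv]
      · exact congrArg c.cell.s2 (Aut.inv_f0 f x)
  map_one := rfl
  map_mul _ _ := rfl
  map_lArr (f : Aut C) (a : (FDer C)ˣ × Aut C) := by
    refine aut_arr_ext rfl (fun x => ?_) fun x => ?_
    · exact congrArg (fun y => f.val.f1 (a.1.val.s0 y)) (Aut.inv_f0 f (a.2.val.f0 x))
    · exact congrArg (fun y => f.val.f2 (a.1.val.s1 y)) (Aut.inv_f1 f (a.2.val.f1 x))
  map_rArr _ _ := rfl
  map_lCell (f : Aut C) (c : M2 C × Aut C) := by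
    refine aut_cell_ext rfl fun x => ?_
    exact congrArg (fun y => f.val.f2 (c.1.s2 y)) (Aut.inv_f0 f (c.2.val.f0 x))
  map_rCell _ _ := rfl
  map_braid (a b : (FDer C)ˣ × Aut C) := by
    refine aut_cell_ext rfl fun x => ?_
    obtain ⟨s, f⟩ := a
    obtain ⟨t, k⟩ := b
    change C.act (((actorTwoCrossed C).lift s⁻¹ (Units.map (FDer.conj f⁻¹) t)).s2
      (C.src (s.val.s0 (f.val.f0 (k.val.f0 x))))) (s.val.s0 (f.val.f0 (k.val.f0 x))) _ =
      s.val.s1 (f.val.f1 (t.val.s0 (k.val.f0 x)))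
    simp only [actorTwoCrossed_lift_s2]
    have h := act_inv_s1 s (f.val.f1 (t.val.s0 (k.val.f0 x)))
    -- The two conjugations inside the lifting for `s⁻¹` bring the argument to the form `Δ s` of an
    -- arrow, to which `act_inv_s1` applies; the two signs then cancel.
    have e : (FDer.conj (deltaAut s⁻¹) (Units.map (FDer.conj f⁻¹) t).val).s0
        (C.src (s.val.s0 (f.val.f0 (k.val.f0 x)))) =
        s.val.Δ.f1 (f.val.f1 (t.val.s0 (k.val.f0 x))) := by
      simp
    simp only [e, act_neg]
    simp only [Hom.tgt_f1, FDer.tgt_s0] at h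
    rw [h, neg_neg]

end

end XMod

/-! ### The three assertions together. -/

theorem mainTheorem1 (C : XMod.{u, v, w}) :
    -- `AUT(C)` is a braided regular crossed module,
    ∃ hA : (XMod.autBimorphism C).IsBraided,
      -- `M₂(C) → FDer*(C) → Aut(C)` is a 2-crossed module,
      ∃ hT : (XMod.actorTwoCrossed C).IsTwoCrossed,
        -- it is isomorphic to the 2-crossed module associated with `AUT(C)`, by the evident
        -- identifications, which carry the Peiffer lifting `{a⁻¹, b} ! a` of `a = (s₀, s₁, 1)`
        -- and `b = (t₀, t₁, 1)` to `x ↦ s₁⁻¹ ((s₀⁻¹ * t₀ * s₀) x)`,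
        (∃ φ : (XMod.BraidedRegular.mk (XMod.AUT C) (XMod.autBimorphism C) hA).toTwoCrossed.Iso
            (XMod.actorTwoCrossed C),
          (∀ c, (φ.isoL c).s2 = c.cell.cell.s2) ∧
          (∀ a, (φ.isoM a).val.s0 = a.arr.arr.s.s0 ∧ (φ.isoM a).val.s1 = a.arr.arr.s.s1) ∧
          (∀ f, φ.isoP f = f) ∧
          (∀ a b x,
            (φ.isoL ((XMod.BraidedRegular.mk (XMod.AUT C) (XMod.autBimorphism C)
                hA).toTwoCrossed.lift a b)).s2 x =
              (XMod.derPart (φ.isoM a))⁻¹.val.val.s1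
                (((Units.map XMod.FDer.toSect (φ.isoM a))⁻¹ *
                  Units.map XMod.FDer.toSect (φ.isoM b) *
                  Units.map XMod.FDer.toSect (φ.isoM a)).val.s0 x))) ∧
        -- and its associated braided regular crossed module is isomorphic to `AUT(C)`.
        (∃ ψ : (XMod.ofTwoCrossedBimorphism (XMod.actorTwoCrossed C) hT).Iso
            (XMod.autBimorphism C), ∀ f, ψ.hom.f0 f = f) := by
  have hA : (XMod.autBimorphism C).IsBraided := (XMod.endBimorphism_isBraided C).restrict _
  have hT := XMod.actorTwoCrossed_isTwoCrossed C
  exact ⟨hA, hT,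
    ⟨XMod.autTwoCrossedIso C hA, fun _ => rfl, fun _ => ⟨rfl, rfl⟩, fun _ => rfl,
      fun a b x => congrArg (fun c : XMod.M2 C => c.s2 x) (XMod.vertexEquiv_lift hA a b)⟩,
    ⟨XMod.ofActorIso C hA hT, fun _ => rfl⟩⟩
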